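/- **Setting.** A queueing network consists of a finite set $\mathcal N$ of nodes, a set $\mathcal L\subseteq\mathcal N\times\mathcal N$ of directed links, finite sets $\mathcal S$ (link states) and $\mathcal I$ (resource allocation decisions), link rates $\hat\mu_{ij}(s,I)\ge 0$ for $(i,j)\in\mathcal L$, $s\in\mathcal S$, $I\in\mathcal I$ (and $\hat\mu_{ij}=0$ for $(i,j)\notin\mathcal L$), and link state frequencies $(\pi_s)_{s\in\mathcal S}$ (a probability vector). Time is slotted, $t=0,1,2,\dots$. On a probability space with a filtration $(\mathcal F_t)$, where $\mathcal F_t$ is the history before slot $t$ and everything that happens in slot $t$ is $\mathcal F_{t+1}$-measurable, there are link states $S(t)\in\mathcal S$ and arrivals $A_i^{(c)}(t)\ge 0$ (packets for destination $c$ generated at node $i$), $A_i^{(i)}(t)=0$. They are *admissible with rates* $\lambda=(\lambda_i^{(c)})$ if $\sup_{i,t}\mathbb E[(\sum_c A_i^{(c)}(t))^2]<\infty$ and for every $\delta>0$ there is $K\ge1$ such that for all $t_0\ge 0$, almost surely, $$\Big|\mathbb E\Big[\tfrac1K\sum_{\tau=t_0}^{t_0+K-1}A_i^{(c)}(\tau)\,\Big|\,\mathcal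 F_{t_0}\Big]-\lambda_i^{(c)}\Big|\le\delta\ \text{ for all } i,c,\qquad \sum_{s\in\mathcal S}\Big|\mathbb E\Big[\tfrac1K\sum_{\tau=t_0}^{t_0+K-1}\mathbf 1_{[S(\tau)=s]}\,\Big|\,\mathcal F_{t_0}\Big]-\pi_s\Big|\le\delta .$$ A *routing algorithm* chooses in each slot, $\mathcal F_{t+1}$-measurably, $I(t)\in\mathcal I$ and offered rates $\mu_{ij}^{(c)}(t)\ge0$ with $\sum_c\mu_{ij}^{(c)}(t)\le\hat\mu_{ij}(S(t),I(t))$. The amounts actually sent satisfy $0\le f_{ij}^{(c)}(t)\le\mu_{ij}^{(c)}(t)$ and $\sum_j f_{ij}^{(c)}(t)=\min\{U_i^{(c)}(t),\sum_j\mu_{ij}^{(c)}(t)\}$. The queue lengths satisfy $U_i^{(i)}(t)=0$ and, for $i\ne c$, $$U_i^{(c)}(t+1)=U_i^{(c)}(t)-\sum_jf_{ij}^{(c)}(t)+\sum_kf_{ki}^{(c)}(t)+A_i^{(c)}(t),$$ where $U_i^{(c)}(0)\ge0$ is $\mathcal F_0$-measurable and square integrable. The network is *stable* if for all $i,c$ $$\lim_{V\to\infty}\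 \limsup_{t\to\infty}\ \mathbb E\Big[\tfrac1t\sum_{\tau<t}\mathbf 1_{[U_i^{(c)}(\tau)>V]}\Big]=0 .$$ The *stability region* $\Lambda$ is the closure of the set of $\lambda$ for which the network is stable under some routing algorithm with some admissible arrivals and link states of rates $\lambda$ and frequencies $\pi$. An algorithm is *throughput optimal* if, whenever $\varepsilon>0$ and the rates equal to $\lambda_i^{(c)}+\varepsilon$ for $i\neq c$ and $\lambda_i^{(i)}$ on the diagonal lie in $\Lambda$, the network is stable under the algorithm for all admissible arrivals and link states with rates $\lambda$. **BPBias.** Let $B_{\max}>0$. Given biases with $0\le B_i^{(c)}(t)\le B_{\max}$ and $B_i^{(i)}(t)=0$, extracted in any way from the network, BPBias acts in slot $t$ as follows. For each link $(i,j)$ it takes a maximizer $c^*_{ij}$ over $c\in\mathcal N$ of $(U_i^{(c)}(t)+B_i^{(c)}(t))-(U_j^{(c)}(t)+B_j^{(c)}(t))$ and lets $W^*_{ij}$ be the positive part of the maximum. It takes $I(t)$ maximizing $\sum_{(i,j)\in\mathcal L}\hat\mu_{ij}(S(t),I)W_{ij}^*$ over $I\in\mathcal I$, and offers $\mu_{ij}^{(c)}(t)=\hat\mu_{ij}(S(t),I(t))$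 if $c=c_{ij}^*$ and $W^*_{ij}>0$, and $\mu_{ij}^{(c)}(t)=0$ otherwise. Ties are broken arbitrarily. **QL-BP.** Let $0<\alpha,\gamma\le1$. QL-BP is BPBias with the following biases. Starting from estimates $Q_{ij}^{(c)}\in[0,B_{\max}]$, in each slot $t$ all estimates are updated simultaneously by $$Q_{ij}^{(c)}\leftarrow\min\Big\{(1-\alpha)Q_{ij}^{(c)}+\alpha\big[U_j^{(c)}(t)+\gamma\, m_j^{(c)}\big],\,B_{\max}\Big\},\qquad m_i^{(c)}=\min_{k:(i,k)\in\mathcal L}Q_{ik}^{(c)}\ (i\ne c),\quad m_c^{(c)}=0$$ (with $m_i^{(c)}=B_{\max}$ if $i\neq c$ and no link leaves $i$), and then $B_i^{(c)}(t)=m_i^{(c)}$, computed from the updated estimates. **Theorem (QL-BP Throughput-Optimality).** For every queueing network and every $B_{\max}>0$: (a) BPBias is throughput optimal, for every choice of biases bounded by $B_{\max}$ as above; (b) in particular QL-BP is throughput optimal, for all $0<\alpha,\gamma\le1$ and all initial estimates in $[0,B_{\max}]$. -/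

import Mathlib

open MeasureTheory Filter Topology

universe u

noncomputable section

namespace Backpressure

/-- A slotted multi-hop queueing network: nodes `N`, directed links, a finite space `St` of link
states, a finite space `Act` of resource allocation decisions, the transmission rate
`rate i j s a` of the link `(i, j)` in state `s` under the decision `a`, and the steady-state
frequencies `freq s` of the link states. Pairs that are not links have rate zero, so that sums over
all pairs of nodes are sums over links. -/
structure Network (N St Act : Type*) [Fintype N] [Fintype St] where
  links : Finset (N × N)
  rate : N → N → St → Act → ℝ
  rate_nonneg : ∀ i j s a, 0 ≤ rate i j s a
  rate_eq_zero : ∀ i j s a, (i, j) ∉ links → rate i j s a = 0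
  freq : St → ℝ
  freq_nonneg : ∀ s, 0 ≤ freq s
  freq_sum : ∑ s, freq s = 1

/-- Everything that happens in a network along time, on a sample space `Ω`.
`arr t i c` : packets for destination `c` generated at node `i` in slot `t`;
`state t` : link states in slot `t`;
`act t` : resource allocation decision in slot `t`;
`offered t i j c` : transmission rate offered to commodity `c` over `(i, j)` in slot `t`;
`sent t i j c` : amount of commodity `c` actually transmitted over `(i, j)` in slot `t`;
`queue t i c` : backlog of commodity `c` at node `i` at the beginning of slot `t`. -/
structure Trajectory (N St Act Ω : Type*) where
  arr : ℕ → N → N → Ω → ℝ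
  state : ℕ → Ω → St
  act : ℕ → Ω → Act
  offered : ℕ → N → N → N → Ω → ℝ
  sent : ℕ → N → N → N → Ω → ℝ
  queue : ℕ → N → N → Ω → ℝ

variable {N St Act : Type*} [Fintype N] [DecidableEq N] [Fintype St] [DecidableEq St]
variable {Ω : Type*} [mΩ : MeasurableSpace Ω]

/-- The arrivals and the link states are admissible with packet generating rates `lam`.
The σ-algebra `F t` is the history of the network before slot `t`; what happens in slot `t` belongs
to `F (t + 1)`. For every tolerance `δ` there is a convergence interval `K` such that, over every
window of `K` slots and whatever the history before the window is, the expected empirical averages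
are `δ`-close to the rates `lam` and to the link state frequencies. -/
structure Admissible (net : Network N St Act) (lam : N → N → ℝ)
    (P : Measure Ω) (F : Filtration ℕ mΩ) (X : Trajectory N St Act Ω) : Prop where
  arr_measurable : ∀ t i c, Measurable[F (t + 1)] (X.arr t i c)
  state_measurable : ∀ t s, MeasurableSet[F (t + 1)] {ω | X.state t ω = s}
  arr_nonneg : ∀ t i c ω, 0 ≤ X.arr t i c ω
  arr_self : ∀ t i ω, X.arr t i i ω = 0
  second_moment : ∃ Amax : ℝ, 0 < Amax ∧ ∀ t i,
    Integrable (fun ω => (∑ c, X.arr t i c ω) ^ 2) P ∧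
      ∫ ω, (∑ c, X.arr t i c ω) ^ 2 ∂P ≤ Amax ^ 2
  convergence : ∀ δ : ℝ, 0 < δ → ∃ K : ℕ, 0 < K ∧ ∀ t₀ : ℕ,
    (∀ i c, ∀ᵐ ω ∂P,
      |(P[fun ω' => (1 / (K : ℝ)) * ∑ τ ∈ Finset.Ico t₀ (t₀ + K), X.arr τ i c ω' | F t₀]) ω
        - lam i c| ≤ δ) ∧
    (∀ᵐ ω ∂P, ∑ s,
      |(P[fun ω' => (1 / (K : ℝ)) * ∑ τ ∈ Finset.Ico t₀ (t₀ + K),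
          (if X.state τ ω' = s then (1 : ℝ) else 0) | F t₀]) ω - net.freq s| ≤ δ)

/-- The trajectory is produced by a (possibly randomized, history dependent) routing algorithm:
decisions in slot `t` are measurable with respect to `F (t + 1)`, the rates offered to the
commodities over a link share the rate of that link, a node sends the offered amount of a commodity
or all it has if this is less, and packets leave the network at their destination. -/
structure IsExecution (net : Network N St Act)
    (P : Measure Ω) (F : Filtration ℕ mΩ) (X : Trajectory N St Act Ω) : Prop where
  act_measurable : ∀ t a, MeasurableSet[F (t + 1)] {ω | X.act t ω = a}
  offered_measurable : ∀ t i j c, Measurable[F (t + 1)] (X.offered t i j c)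
  sent_measurable : ∀ t i j c, Measurable[F (t + 1)] (X.sent t i j c)
  offered_nonneg : ∀ t i j c ω, 0 ≤ X.offered t i j c ω
  offered_le : ∀ t i j ω,
    ∑ c, X.offered t i j c ω ≤ net.rate i j (X.state t ω) (X.act t ω)
  sent_nonneg : ∀ t i j c ω, 0 ≤ X.sent t i j c ω
  sent_le : ∀ t i j c ω, X.sent t i j c ω ≤ X.offered t i j c ω
  sent_sum : ∀ t i c ω,
    ∑ j, X.sent t i j c ω = min (X.queue t i c ω) (∑ j, X.offered t i j c ω)
  queue_init_measurable : ∀ i c, Measurable[F 0] (X.queue 0 i c)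
  queue_init_memLp : ∀ i c, MemLp (X.queue 0 i c) 2 P
  queue_init_nonneg : ∀ i c ω, 0 ≤ X.queue 0 i c ω
  queue_self : ∀ t i ω, X.queue t i i ω = 0
  queue_succ : ∀ t i c ω, i ≠ c →
    X.queue (t + 1) i c ω =
      X.queue t i c ω - ∑ j, X.sent t i j c ω + ∑ k, X.sent t k i c ω + X.arr t i c ω

/-- `overflow P q V` is `g(V) = limsup_t E{(1/t) ∑_{τ < t} 1[q(τ) > V]}`. -/
def overflow (P : Measure Ω) (q : ℕ → Ω → ℝ) (V : ℝ) : ℝ :=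
  limsup (fun t : ℕ =>
    ∫ ω, (1 / (t : ℝ)) * ∑ τ ∈ Finset.range t, (if V < q τ ω then (1 : ℝ) else 0) ∂P) atTop

/-- All queues are stable: `g(V) → 0` as `V → ∞`. -/
def Stable (P : Measure Ω) (X : Trajectory N St Act Ω) : Prop :=
  ∀ i c, Tendsto (overflow P (fun t => X.queue t i c)) atTop (𝓝 0)

/-- The rates `lam` are supported: some routing algorithm stabilizes the network under packet
generating rates `lam`. -/
def Supported (net : Network N St Act) (lam : N → N → ℝ) : Prop :=
  ∃ (Ω : Type) (mΩ : MeasurableSpace Ω) (P : Measure Ω) (F : Filtration ℕ mΩ)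
    (X : Trajectory N St Act Ω),
    IsProbabilityMeasure P ∧ Admissible net lam P F X ∧ IsExecution net P F X ∧ Stable P X

/-- The network stability region `Λ`. -/
def stabilityRegion (net : Network N St Act) : Set (N → N → ℝ) :=
  closure {lam | Supported net lam}

/-- An algorithm, given as the property `Alg` of a trajectory to follow its rules, is throughput
optimal: it stabilizes the network for all rates `lam` such that `lam i c + ε`, `i ≠ c`, lie in the
stability region for some `ε > 0`. -/
def ThroughputOptimal (net : Network N St Act)
    (Alg : ∀ Ω : Type u, Trajectory N St Act Ω → Prop) : Prop :=
  ∀ (lam : N → N → ℝ) (ε : ℝ), 0 < ε →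
    (fun i c => if i = c then lam i c else lam i c + ε) ∈ stabilityRegion net →
    ∀ (Ω : Type u) (mΩ : MeasurableSpace Ω) (P : Measure Ω) (F : Filtration ℕ mΩ)
      (X : Trajectory N St Act Ω),
      IsProbabilityMeasure P → Admissible net lam P F X → IsExecution net P F X →
      Alg Ω X → Stable P X

/-- The biased backlog difference of commodity `c` over `(i, j)`, for backlogs `q`, biases `b`. -/
def pressure (q b : N → N → ℝ) (i j c : N) : ℝ := (q i c + b i c) - (q j c + b j c)

/-- One slot of biased backpressure with backlogs `q`, biases `b`, link states `s`: each link picks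
an optimal commodity `cstar i j`, the decision `a` maximizes the weighted sum of link rates with the
weights `W i j = max (pressure difference of the optimal commodity) 0`, and each link of positive weight offers
its whole rate to its optimal commodity. Ties are broken arbitrarily. -/
def BackpressureSlot (net : Network N St Act) (q b : N → N → ℝ) (s : St) (a : Act)
    (offered : N → N → N → ℝ) : Prop :=
  ∃ (cstar : N → N → N) (W : N → N → ℝ),
    (∀ i j, (i, j) ∈ net.links → ∀ c, pressure q b i j c ≤ pressure q b i j (cstar i j)) ∧
    (∀ i j, W i j = max (pressure q b i j (cstar i j)) 0) ∧
    (∀ a', ∑ l ∈ net.links, net.rate l.1 l.2 s a' * W l.1 l.2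
      ≤ ∑ l ∈ net.links, net.rate l.1 l.2 s a * W l.1 l.2) ∧
    (∀ i j c, (i, j) ∈ net.links →
      offered i j c = if c = cstar i j ∧ 0 < W i j then net.rate i j s a else 0)

/-- The trajectory follows biased backpressure routing with bias `B t i c` in slot `t`. -/
def FollowsBias (net : Network N St Act) {Ω : Type*} (X : Trajectory N St Act Ω)
    (B : ℕ → N → N → Ω → ℝ) : Prop :=
  ∀ t ω, BackpressureSlot net (fun i c => X.queue t i c ω) (fun i c => B t i c ω)
    (X.state t ω) (X.act t ω) (fun i j c => X.offered t i j c ω)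

/-- The framework BPBias: biased backpressure with some bias bounded by `Bmax`; the way in which
the bias is extracted from the network is free. -/
def IsBPBias (net : Network N St Act) (Bmax : ℝ) (Ω : Type u) (X : Trajectory N St Act Ω) : Prop :=
  ∃ B : ℕ → N → N → Ω → ℝ,
    (∀ t i c ω, 0 ≤ B t i c ω ∧ B t i c ω ≤ Bmax) ∧ (∀ t i ω, B t i i ω = 0) ∧
    FollowsBias net X B

/-- The neighbors to which node `i` has a link. -/
def neighbors (net : Network N St Act) (i : N) : Finset N :=
  Finset.univ.filter fun j => (i, j) ∈ net.links

/-- Least route congestion estimate `min_j Q i j c` of node `i` for commodity `c`: zero at the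
destination itself, and the cap `Bmax` at a node from which no link leaves. -/
def leastEstimate (net : Network N St Act) (Bmax : ℝ) (Q : N → N → N → ℝ) (i c : N) : ℝ :=
  if i = c then 0
  else if h : (neighbors net i).Nonempty then (neighbors net i).inf' h (fun j => Q i j c)
  else Bmax

/-- The tables of route congestion estimates: `estimates … q t` are those at the beginning of slot
`t`, along the backlogs `q`, and the Q-learning update of slot `t` turns them into those at `t + 1`,
capped at `Bmax`. -/
def estimates (net : Network N St Act) (α γ Bmax : ℝ) (Q₀ : N → N → N → ℝ)
    (q : ℕ → N → N → ℝ) : ℕ → N → N → N → ℝ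
  | 0 => Q₀
  | t + 1 => fun i j c =>
      min ((1 - α) * estimates net α γ Bmax Q₀ q t i j c
        + α * (q t j c + γ * leastEstimate net Bmax (estimates net α γ Bmax Q₀ q t) j c)) Bmax

/-- The algorithm QL-BP with parameters `α`, `γ`, `Bmax` and initial estimates `Q₀`: biased
backpressure with the updated least estimates as biases. -/
def IsQLBP (net : Network N St Act) (α γ Bmax : ℝ) (Q₀ : N → N → N → ℝ)
    (Ω : Type u) (X : Trajectory N St Act Ω) : Prop :=
  FollowsBias net X fun t i c ω =>
    leastEstimate net Bmax
      (estimates net α γ Bmax Q₀ (fun τ k d => X.queue τ k d ω) (t + 1)) i c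

end Backpressure

end

/-! Everything rests on a family of linear inequalities indexed by backlog vectors `w ≥ 0` vanishing
on the diagonal: the inner product of `w` with the rates is at most the mean, over link states, of
`maxWeight net w`, the best weighted rate sum when `w` plays the role of the backlogs. No stationary
policy is constructed and no duality is needed, since both halves of the argument speak only of
these inequalities.

Necessity (`le_maxWeight_of_stable`): under any algorithm the linear functional `w · U` loses at
most `maxWeight net w` per slot and gains `w · A`, so a violated inequality makes its mean grow
linearly. Stability only says that overflow is rare on time average, which alone does not preclude a
growing mean. But second moments of backlogs grow at most quadratically, so rare overflow does force
the mean to be small compared with time. Each inequality is closed in the rates and therefore holds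
on all of the stability region.

Sufficiency (`exists_negative_drift`): take `w` to be the current backlog. Biased backpressure
attains `maxWeight` up to a constant, because bounded biases shift each pressure by at most `Bmax`
(`maxWeight_le_of_backpressureSlot`). Over a convergence window the weights can be frozen at its
start, at a cost independent of the backlogs, so that conditional averages of arrivals and states
may be replaced by their limits. The slack `ε` then gives a drift of the quadratic Lyapunov function
below a constant minus a multiple of the total backlog. Summing the drift bounds time-averaged
backlogs, and Markov's inequality gives stability.

QL-BP is an instance, since capped estimates are bounded biases (`isBPBias_of_isQLBP`). -/

namespace Backpressure

/-! ### Max-weight functional and one-slot inequalities -/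

section Deterministic

variable {N St Act : Type*} [Fintype N] [Fintype St]

/-- The unbiased backpressure weight of the link `(i, j)` for backlogs `w`. -/
noncomputable def linkWeight (w : N → N → ℝ) (i j : N) : ℝ := ⨆ c, max (w i c - w j c) 0

/-- The largest weighted sum of link rates in state `s`, for backlogs `w`. -/
noncomputable def maxWeight (net : Network N St Act) (w : N → N → ℝ) (s : St) : ℝ :=
  ⨆ a, ∑ i, ∑ j, net.rate i j s a * linkWeight w i j

/-- `R` bounds the sum of all link rates, whatever the link states and the decision are. -/
def RateBound (net : Network N St Act) (R : ℝ) : Prop :=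
  ∀ s a, ∑ i, ∑ j, net.rate i j s a ≤ R

theorem exists_rateBound [Finite Act] (net : Network N St Act) :
    ∃ R, 0 ≤ R ∧ RateBound net R := by
  obtain ⟨M, hM⟩ := (Set.finite_range
    fun p : St × Act => ∑ i, ∑ j, net.rate i j p.1 p.2).bddAbove
  exact ⟨max M 0, le_max_right _ _, fun s a => (hM ⟨(s, a), rfl⟩).trans (le_max_left _ _)⟩

theorem le_linkWeight (w : N → N → ℝ) (i j c : N) :
    max (w i c - w j c) 0 ≤ linkWeight w i j :=
  le_ciSup (f := fun c => max (w i c - w j c) 0) (Set.finite_range _).bddAbove c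

theorem linkWeight_nonneg (w : N → N → ℝ) (i j : N) : 0 ≤ linkWeight w i j :=
  (le_max_right _ _).trans (le_linkWeight w i j i)

theorem linkWeight_le {ι : Type*} {w : ι → ι → ℝ} {i j : ι} {M : ℝ}
    (h : ∀ c, max (w i c - w j c) 0 ≤ M) : linkWeight w i j ≤ M :=
  have : Nonempty ι := ⟨i⟩
  ciSup_le h

theorem linkWeight_le_add {w w' : N → N → ℝ} {D : ℝ} (h : ∀ i c, |w i c - w' i c| ≤ D)
    (i j : N) : linkWeight w i j ≤ linkWeight w' i j + 2 * D := by
  refine linkWeight_le fun c => ?_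
  have h₁ := abs_le.1 (h i c)
  have h₂ := abs_le.1 (h j c)
  have h₃ := le_linkWeight w' i j c
  have h₄ := le_max_left (w' i c - w' j c) 0
  have h₅ := le_max_right (w' i c - w' j c) 0
  exact max_le (by linarith) (by linarith)

theorem le_sum_sum {w : N → N → ℝ} (hw : ∀ i c, 0 ≤ w i c) (i c : N) :
    w i c ≤ ∑ i, ∑ c, w i c :=
  (Finset.single_le_sum (fun c _ => hw i c) (Finset.mem_univ c)).trans
    (Finset.single_le_sum (f := fun i => ∑ c, w i c)
      (fun i _ => Finset.sum_nonneg fun c _ => hw i c) (Finset.mem_univ i))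

theorem linkWeight_le_sum {w : N → N → ℝ} (hw : ∀ i c, 0 ≤ w i c) (i j : N) :
    linkWeight w i j ≤ ∑ i, ∑ c, w i c := by
  refine linkWeight_le fun c => max_le ?_ ?_
  · linarith [hw j c, le_sum_sum hw i c]
  · exact (hw i c).trans (le_sum_sum hw i c)

theorem le_maxWeight [Finite Act] (net : Network N St Act) (w : N → N → ℝ) (s : St) (a : Act) :
    ∑ i, ∑ j, net.rate i j s a * linkWeight w i j ≤ maxWeight net w s :=
  le_ciSup (f := fun a => ∑ i, ∑ j, net.rate i j s a * linkWeight w i j)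
    (Set.finite_range _).bddAbove a

theorem maxWeight_nonneg (net : Network N St Act) (w : N → N → ℝ) (s : St) :
    0 ≤ maxWeight net w s :=
  Real.iSup_nonneg fun _ => Finset.sum_nonneg fun _ _ => Finset.sum_nonneg fun _ _ =>
    mul_nonneg (net.rate_nonneg _ _ _ _) (linkWeight_nonneg _ _ _)

/-- Each link weight is `2`-Lipschitz in the sup norm and the rates sum to at most `R`. This is what
allows weights to be frozen at the start of a window. -/
theorem maxWeight_le_add [Finite Act] {net : Network N St Act} {R : ℝ} (hR₀ : 0 ≤ R)
    (hR : RateBound net R) {w w' : N → N → ℝ} {D : ℝ} (hD : 0 ≤ D)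
    (h : ∀ i c, |w i c - w' i c| ≤ D) (s : St) :
    maxWeight net w s ≤ maxWeight net w' s + 2 * R * D := by
  -- `Act` may be empty, in which case the supremum is `0`; hence the nonnegativity side goal.
  refine Real.iSup_le (fun a => ?_) (by have := maxWeight_nonneg net w' s; positivity)
  calc ∑ i, ∑ j, net.rate i j s a * linkWeight w i j
      ≤ ∑ i, ∑ j, (net.rate i j s a * linkWeight w' i j + net.rate i j s a * (2 * D)) := by
        refine Finset.sum_le_sum fun i _ => Finset.sum_le_sum fun j _ => ?_
        rw [← mul_add]
        exact mul_le_mul_of_nonneg_left (linkWeight_le_add h i j) (net.rate_nonneg _ _ _ _)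
    _ = ∑ i, ∑ j, net.rate i j s a * linkWeight w' i j
          + (∑ i, ∑ j, net.rate i j s a) * (2 * D) := by
        simp only [Finset.sum_add_distrib, Finset.sum_mul]
    _ ≤ maxWeight net w' s + R * (2 * D) :=
        add_le_add (le_maxWeight net w' s a) (mul_le_mul_of_nonneg_right (hR s a) (by linarith))
    _ = _ := by ring

theorem maxWeight_le_mul_sum {net : Network N St Act} {R : ℝ} (hR₀ : 0 ≤ R)
    (hR : RateBound net R) {w : N → N → ℝ} (hw : ∀ i c, 0 ≤ w i c) (s : St) :
    maxWeight net w s ≤ R * ∑ i, ∑ c, w i c := by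
  have hS : 0 ≤ ∑ i, ∑ c, w i c :=
    Finset.sum_nonneg fun i _ => Finset.sum_nonneg fun c _ => hw i c
  refine Real.iSup_le (fun a => ?_) (by positivity)
  calc ∑ i, ∑ j, net.rate i j s a * linkWeight w i j
      ≤ ∑ i, ∑ j, net.rate i j s a * ∑ i, ∑ c, w i c :=
        Finset.sum_le_sum fun i _ => Finset.sum_le_sum fun j _ =>
          mul_le_mul_of_nonneg_left (linkWeight_le_sum hw i j) (net.rate_nonneg _ _ _ _)
    _ = (∑ i, ∑ j, net.rate i j s a) * ∑ i, ∑ c, w i c := by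
        simp only [Finset.sum_mul]
    _ ≤ _ := mul_le_mul_of_nonneg_right (hR s a) hS

/-- Summation by parts: reindexing the incoming flow moves the differences onto `w`. It turns queue
dynamics into the link differences that backpressure optimizes. -/
theorem sum_mul_netFlow (w : N → N → ℝ) (x : N → N → N → ℝ) :
    ∑ i, ∑ c, w i c * (∑ j, x i j c - ∑ k, x k i c)
      = ∑ i, ∑ j, ∑ c, x i j c * (w i c - w j c) := by
  simp only [mul_sub, Finset.sum_sub_distrib, Finset.mul_sum]
  congr 1
  · refine Finset.sum_congr rfl fun i _ => ?_
    rw [Finset.sum_comm]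
    simp only [mul_comm]
  · rw [Finset.sum_congr rfl fun i _ => Finset.sum_comm, Finset.sum_comm]
    simp only [mul_comm]

/-- No way of sharing the link rates among the commodities beats the maximal weight. -/
theorem sum_flow_le_maxWeight [Finite Act] (net : Network N St Act) (w : N → N → ℝ)
    (s : St) (a : Act) {x : N → N → N → ℝ} (hx : ∀ i j c, 0 ≤ x i j c)
    (hxa : ∀ i j, ∑ c, x i j c ≤ net.rate i j s a) :
    ∑ i, ∑ j, ∑ c, x i j c * (w i c - w j c) ≤ maxWeight net w s := by
  refine le_trans ?_ (le_maxWeight net w s a)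
  refine Finset.sum_le_sum fun i _ => Finset.sum_le_sum fun j _ => ?_
  calc ∑ c, x i j c * (w i c - w j c) ≤ ∑ c, x i j c * linkWeight w i j :=
        Finset.sum_le_sum fun c _ => mul_le_mul_of_nonneg_left
          ((le_max_left _ _).trans (le_linkWeight w i j c)) (hx i j c)
    _ = (∑ c, x i j c) * linkWeight w i j := by rw [Finset.sum_mul]
    _ ≤ _ := mul_le_mul_of_nonneg_right (hxa i j) (linkWeight_nonneg _ _ _)

theorem sum_links_eq (net : Network N St Act) (s : St) (a : Act) (W : N → N → ℝ) :
    ∑ l ∈ net.links, net.rate l.1 l.2 s a * W l.1 l.2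
      = ∑ i, ∑ j, net.rate i j s a * W i j := by
  rw [← Fintype.sum_prod_type' fun i j => net.rate i j s a * W i j]
  refine Finset.sum_subset (Finset.subset_univ _) fun l _ hl => ?_
  rw [net.rate_eq_zero _ _ _ _ hl, zero_mul]

/-- Biased backpressure attains the maximal unbiased weight up to a constant. -/
theorem maxWeight_le_of_backpressureSlot [DecidableEq N] {net : Network N St Act}
    {R : ℝ} (hR : RateBound net R) {B : ℝ} (hB₀ : 0 ≤ B) {q b : N → N → ℝ}
    (hb : ∀ i c, 0 ≤ b i c ∧ b i c ≤ B) {s : St} {a : Act} {x : N → N → N → ℝ}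
    (hx : ∀ i j c, 0 ≤ x i j c) (hxa : ∀ i j, ∑ c, x i j c ≤ net.rate i j s a)
    (h : BackpressureSlot net q b s a x) :
    maxWeight net q s ≤ ∑ i, ∑ j, ∑ c, x i j c * (q i c - q j c) + 2 * R * B := by
  obtain ⟨cstar, W, hc, hW, ha, ho⟩ := h
  simp only [sum_links_eq] at ha
  have hxW : ∀ i j, ∑ c, x i j c * pressure q b i j c = net.rate i j s a * W i j := by
    intro i j
    by_cases hl : (i, j) ∈ net.links
    · simp only [ho i j _ hl]
      by_cases hpos : 0 < W i j
      · have : W i j = pressure q b i j (cstar i j) := by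
          rw [hW] at hpos ⊢
          exact max_eq_left_iff.2 (by
            by_contra hneg
            rw [max_eq_right (not_le.1 hneg).le] at hpos
            exact lt_irrefl _ hpos)
        simp [hpos, ← this]
      · have h0 : W i j = 0 := le_antisymm (not_lt.1 hpos) (by rw [hW]; exact le_max_right _ _)
        simp [h0]
    -- The slot rule says nothing off the links; there the zero capacity forces the offered rates to
    -- vanish.
    · have h0 := net.rate_eq_zero i j s a hl
      have hz : ∀ c, x i j c = 0 := fun c =>
        le_antisymm ((Finset.single_le_sum (fun c _ => hx i j c) (Finset.mem_univ c)).trans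
          ((hxa i j).trans h0.le)) (hx i j c)
      simp [hz, h0]
  -- The bias costs `B` per unit of rate twice: here in passing from unbiased to biased weights, and
  -- in `hxq` in passing back.
  have hlW : ∀ a' i j, net.rate i j s a' * linkWeight q i j
      ≤ net.rate i j s a' * W i j + net.rate i j s a' * B := by
    intro a' i j
    by_cases hl : (i, j) ∈ net.links
    · rw [← mul_add]
      refine mul_le_mul_of_nonneg_left (linkWeight_le fun c => ?_) (net.rate_nonneg _ _ _ _)
      have h₁ := hc i j hl c
      have h₂ := le_max_left (pressure q b i j (cstar i j)) 0
      have h₃ := le_max_right (pressure q b i j (cstar i j)) 0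
      rw [← hW] at h₂ h₃
      have h₄ : pressure q b i j c = (q i c + b i c) - (q j c + b j c) := rfl
      exact max_le (by linarith [(hb i c).1, (hb j c).2]) (by linarith)
    · simp [net.rate_eq_zero i j s a' hl]
  have hxq : ∀ i j, net.rate i j s a * W i j
      ≤ ∑ c, x i j c * (q i c - q j c) + net.rate i j s a * B := by
    intro i j
    calc net.rate i j s a * W i j
        = ∑ c, x i j c * (q i c - q j c) + ∑ c, x i j c * (b i c - b j c) := by
          rw [← hxW, ← Finset.sum_add_distrib]
          refine Finset.sum_congr rfl fun c _ => ?_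
          rw [pressure]; ring
      _ ≤ ∑ c, x i j c * (q i c - q j c) + ∑ c, x i j c * B := by
          refine add_le_add le_rfl (Finset.sum_le_sum fun c _ =>
            mul_le_mul_of_nonneg_left ?_ (hx i j c))
          linarith [(hb i c).2, (hb j c).1]
      _ ≤ _ := by
          rw [← Finset.sum_mul]
          exact add_le_add le_rfl (mul_le_mul_of_nonneg_right (hxa i j) hB₀)
  have hup : ∑ i, ∑ j, net.rate i j s a * W i j
      ≤ ∑ i, ∑ j, ∑ c, x i j c * (q i c - q j c) + R * B := by
    calc ∑ i, ∑ j, net.rate i j s a * W i j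
        ≤ ∑ i, ∑ j, (∑ c, x i j c * (q i c - q j c) + net.rate i j s a * B) :=
          Finset.sum_le_sum fun i _ => Finset.sum_le_sum fun j _ => hxq i j
      _ = ∑ i, ∑ j, ∑ c, x i j c * (q i c - q j c) + (∑ i, ∑ j, net.rate i j s a) * B := by
          simp only [Finset.sum_add_distrib, Finset.sum_mul]
      _ ≤ _ := add_le_add le_rfl (mul_le_mul_of_nonneg_right (hR s a) hB₀)
  have : Nonempty Act := ⟨a⟩
  refine ciSup_le fun a' => ?_
  calc ∑ i, ∑ j, net.rate i j s a' * linkWeight q i j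
      ≤ ∑ i, ∑ j, (net.rate i j s a' * W i j + net.rate i j s a' * B) :=
        Finset.sum_le_sum fun i _ => Finset.sum_le_sum fun j _ => hlW a' i j
    _ = ∑ i, ∑ j, net.rate i j s a' * W i j + (∑ i, ∑ j, net.rate i j s a') * B := by
        simp only [Finset.sum_add_distrib, Finset.sum_mul]
    _ ≤ ∑ i, ∑ j, net.rate i j s a * W i j + R * B :=
        add_le_add (ha a') (mul_le_mul_of_nonneg_right (hR s a') hB₀)
    _ ≤ _ := by linarith

/-- The truncation in `u - min u out` only decreases the square, and the cross term only grows when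
`u - min u out` is replaced by `u`. The bound involves the offered rates `out`, `inn'` instead of
the amounts sent, as the former are what the algorithm controls. -/
theorem sq_queue_update_le {u out inn inn' a : ℝ} (hu : 0 ≤ u) (hout : 0 ≤ out)
    (hinn : 0 ≤ inn) (hle : inn ≤ inn') (ha : 0 ≤ a) :
    (u - min u out + inn + a) ^ 2
      ≤ u ^ 2 + out ^ 2 + (inn' + a) ^ 2 + 2 * (u * a) - 2 * (u * (out - inn')) := by
  have h₁ : 0 ≤ u - min u out := sub_nonneg.2 (min_le_left _ _)
  have h₂ : (u - min u out) ^ 2 ≤ (u - out) ^ 2 := by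
    rcases le_total u out with h | h
    · rw [min_eq_left h]; nlinarith [sq_nonneg (u - out)]
    · rw [min_eq_right h]
  have h₃ : u - min u out ≤ u := by linarith [le_min hu hout]
  have h₄ : (inn + a) ^ 2 ≤ (inn' + a) ^ 2 := pow_le_pow_left₀ (by linarith) (by linarith) 2
  have h₅ : (u - min u out) * (inn + a) ≤ u * (inn' + a) :=
    mul_le_mul h₃ (by linarith) (by linarith) hu
  nlinarith

end Deterministic

/-! ### Sample-path bounds: linear functionals and Lyapunov drift -/

section Pathwise

variable {N St Act : Type*} [Fintype N] [Fintype St]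
variable {Ω : Type*} [mΩ : MeasurableSpace Ω]
variable {net : Network N St Act} {lam : N → N → ℝ} {P : Measure Ω} {F : Filtration ℕ mΩ}
variable {X : Trajectory N St Act Ω} {R : ℝ}

/-- All packets generated in slot `t`. -/
def totalArr (X : Trajectory N St Act Ω) (t : ℕ) (ω : Ω) : ℝ := ∑ i, ∑ c, X.arr t i c ω

/-- The sum of the squared backlogs. -/
def lyapunov (X : Trajectory N St Act Ω) (t : ℕ) (ω : Ω) : ℝ := ∑ i, ∑ c, X.queue t i c ω ^ 2

theorem sum_offered_out_le (hX : IsExecution net P F X) (hR : RateBound net R)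
    (t : ℕ) (i c : N) (ω : Ω) : ∑ j, X.offered t i j c ω ≤ R := by
  have h : ∀ j, X.offered t i j c ω ≤ net.rate i j (X.state t ω) (X.act t ω) := fun j =>
    (Finset.single_le_sum (fun c _ => hX.offered_nonneg t i j c ω) (Finset.mem_univ c)).trans
      (hX.offered_le t i j ω)
  refine (Finset.sum_le_sum fun j _ => h j).trans (le_trans ?_ (hR (X.state t ω) (X.act t ω)))
  exact Finset.single_le_sum (f := fun i => ∑ j, net.rate i j (X.state t ω) (X.act t ω))
    (fun i _ => Finset.sum_nonneg fun j _ => net.rate_nonneg _ _ _ _) (Finset.mem_univ i)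

theorem sum_offered_in_le (hX : IsExecution net P F X) (hR : RateBound net R)
    (t : ℕ) (i c : N) (ω : Ω) : ∑ k, X.offered t k i c ω ≤ R := by
  have h : ∀ k, X.offered t k i c ω ≤ ∑ j, net.rate k j (X.state t ω) (X.act t ω) := fun k =>
    ((Finset.single_le_sum (fun c _ => hX.offered_nonneg t k i c ω) (Finset.mem_univ c)).trans
      (hX.offered_le t k i ω)).trans
      (Finset.single_le_sum (f := fun j => net.rate k j (X.state t ω) (X.act t ω))
        (fun j _ => net.rate_nonneg _ _ _ _) (Finset.mem_univ i))
  exact (Finset.sum_le_sum fun k _ => h k).trans (hR _ _)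

theorem sum_sent_out_nonneg (hX : IsExecution net P F X) (t : ℕ) (i c : N) (ω : Ω) :
    0 ≤ ∑ j, X.sent t i j c ω := Finset.sum_nonneg fun j _ => hX.sent_nonneg t i j c ω

theorem sum_sent_in_nonneg (hX : IsExecution net P F X) (t : ℕ) (i c : N) (ω : Ω) :
    0 ≤ ∑ k, X.sent t k i c ω := Finset.sum_nonneg fun k _ => hX.sent_nonneg t k i c ω

theorem sum_sent_out_le (hX : IsExecution net P F X) (t : ℕ) (i c : N) (ω : Ω) :
    ∑ j, X.sent t i j c ω ≤ ∑ j, X.offered t i j c ω :=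
  Finset.sum_le_sum fun j _ => hX.sent_le t i j c ω

theorem sum_sent_in_le (hX : IsExecution net P F X) (t : ℕ) (i c : N) (ω : Ω) :
    ∑ k, X.sent t k i c ω ≤ ∑ k, X.offered t k i c ω :=
  Finset.sum_le_sum fun k _ => hX.sent_le t k i c ω

/-- A linear function of the backlogs decreases in a slot by at most the maximal weight. -/
theorem sum_mul_queue_succ_ge [Finite Act] (hX : IsExecution net P F X) {w : N → N → ℝ}
    (hw : ∀ c, w c c = 0) (t : ℕ) (ω : Ω) :
    ∑ i, ∑ c, w i c * X.queue t i c ω + ∑ i, ∑ c, w i c * X.arr t i c ω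
        - maxWeight net w (X.state t ω)
      ≤ ∑ i, ∑ c, w i c * X.queue (t + 1) i c ω := by
  have h₁ : ∑ i, ∑ c, w i c * X.queue (t + 1) i c ω
      = ∑ i, ∑ c, w i c * X.queue t i c ω + ∑ i, ∑ c, w i c * X.arr t i c ω
        - ∑ i, ∑ c, w i c * (∑ j, X.sent t i j c ω - ∑ k, X.sent t k i c ω) := by
    simp only [← Finset.sum_add_distrib, ← Finset.sum_sub_distrib]
    refine Finset.sum_congr rfl fun i _ => Finset.sum_congr rfl fun c _ => ?_
    -- Conservation fails at the destination, where delivered packets disappear; the zero diagonal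
    -- of `w` removes these terms.
    by_cases h : i = c
    · subst h; simp [hw]
    · rw [hX.queue_succ t i c ω h, Finset.sum_sub_distrib]; ring
  have h₂ := sum_flow_le_maxWeight net w (X.state t ω) (X.act t ω)
    (x := fun i j c => X.sent t i j c ω) (fun i j c => hX.sent_nonneg t i j c ω)
    (fun i j => (Finset.sum_le_sum fun c _ => hX.sent_le t i j c ω).trans (hX.offered_le t i j ω))
  rw [h₁, sum_mul_netFlow w fun i j c => X.sent t i j c ω]
  linarith

theorem sum_mul_queue_window_ge [Finite Act] (hX : IsExecution net P F X) {w : N → N → ℝ}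
    (hw : ∀ c, w c c = 0) (t₀ K : ℕ) (ω : Ω) :
    ∑ i, ∑ c, w i c * X.queue t₀ i c ω
        + ∑ i, ∑ c, w i c * ∑ τ ∈ Finset.Ico t₀ (t₀ + K), X.arr τ i c ω
        - ∑ τ ∈ Finset.Ico t₀ (t₀ + K), maxWeight net w (X.state τ ω)
      ≤ ∑ i, ∑ c, w i c * X.queue (t₀ + K) i c ω := by
  induction K with
  | zero => simp
  | succ K ih =>
    simp only [← add_assoc, Finset.sum_Ico_succ_top (Nat.le_add_right t₀ K), mul_add,
      Finset.sum_add_distrib]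
    linarith [sum_mul_queue_succ_ge hX hw (t₀ + K) ω]

variable [DecidableEq St]

theorem arr_le_totalArr (hA : Admissible net lam P F X) (t : ℕ) (i c : N) (ω : Ω) :
    X.arr t i c ω ≤ totalArr X t ω :=
  le_sum_sum (w := fun i c => X.arr t i c ω) (fun i c => hA.arr_nonneg t i c ω) i c

theorem totalArr_nonneg (hA : Admissible net lam P F X) (t : ℕ) (ω : Ω) : 0 ≤ totalArr X t ω :=
  Finset.sum_nonneg fun i _ => Finset.sum_nonneg fun c _ => hA.arr_nonneg t i c ω

theorem queue_nonneg (hX : IsExecution net P F X) (hA : Admissible net lam P F X)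
    (t : ℕ) (i c : N) (ω : Ω) : 0 ≤ X.queue t i c ω := by
  cases t with
  | zero => exact hX.queue_init_nonneg i c ω
  | succ t =>
    by_cases h : i = c
    · subst h; rw [hX.queue_self]
    · rw [hX.queue_succ t i c ω h, hX.sent_sum]
      linarith [min_le_left (X.queue t i c ω) (∑ j, X.offered t i j c ω),
        sum_sent_in_nonneg hX t i c ω, hA.arr_nonneg t i c ω]

theorem abs_queue_succ_sub_le (hX : IsExecution net P F X) (hA : Admissible net lam P F X)
    (hR₀ : 0 ≤ R) (hR : RateBound net R) (t : ℕ) (i c : N) (ω : Ω) :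
    |X.queue (t + 1) i c ω - X.queue t i c ω| ≤ R + totalArr X t ω := by
  have ha := totalArr_nonneg hA t ω
  by_cases h : i = c
  · subst h
    simp only [hX.queue_self, sub_self, abs_zero]
    positivity
  · rw [hX.queue_succ t i c ω h, abs_le]
    have h₁ := sum_sent_out_nonneg hX t i c ω
    have h₂ := sum_sent_in_nonneg hX t i c ω
    have h₃ := (sum_sent_out_le hX t i c ω).trans (sum_offered_out_le hX hR t i c ω)
    have h₄ := (sum_sent_in_le hX t i c ω).trans (sum_offered_in_le hX hR t i c ω)
    have h₅ := arr_le_totalArr hA t i c ω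
    have h₆ := hA.arr_nonneg t i c ω
    constructor <;> linarith

theorem abs_queue_sub_le (hX : IsExecution net P F X) (hA : Admissible net lam P F X)
    (hR₀ : 0 ≤ R) (hR : RateBound net R) (t₀ m : ℕ) (i c : N) (ω : Ω) :
    |X.queue (t₀ + m) i c ω - X.queue t₀ i c ω|
      ≤ ∑ r ∈ Finset.Ico t₀ (t₀ + m), (R + totalArr X r ω) := by
  induction m with
  | zero => simp
  | succ m ih =>
    rw [← add_assoc, Finset.sum_Ico_succ_top (Nat.le_add_right _ _)]
    have h := abs_queue_succ_sub_le hX hA hR₀ hR (t₀ + m) i c ω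
    have h' := abs_sub_le (X.queue (t₀ + m + 1) i c ω) (X.queue (t₀ + m) i c ω)
      (X.queue t₀ i c ω)
    linarith

theorem abs_queue_sub_le_window (hX : IsExecution net P F X) (hA : Admissible net lam P F X)
    (hR₀ : 0 ≤ R) (hR : RateBound net R) (t₀ K : ℕ) {τ : ℕ}
    (hτ : τ ∈ Finset.Ico t₀ (t₀ + K)) (i c : N) (ω : Ω) :
    |X.queue τ i c ω - X.queue t₀ i c ω|
      ≤ ∑ r ∈ Finset.Ico t₀ (t₀ + K), (R + totalArr X r ω) := by
  obtain ⟨h₁, h₂⟩ := Finset.mem_Ico.1 hτ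
  obtain ⟨m, rfl⟩ := Nat.exists_eq_add_of_le h₁
  refine (abs_queue_sub_le hX hA hR₀ hR t₀ m i c ω).trans ?_
  exact Finset.sum_le_sum_of_subset_of_nonneg (Finset.Ico_subset_Ico_right h₂.le)
    fun r _ _ => add_nonneg hR₀ (totalArr_nonneg hA r ω)

theorem sum_sq_arr_le (hA : Admissible net lam P F X) (t : ℕ) (ω : Ω) :
    ∑ i, ∑ c, X.arr t i c ω ^ 2 ≤ totalArr X t ω ^ 2 := by
  calc ∑ i, ∑ c, X.arr t i c ω ^ 2 ≤ ∑ i, ∑ c, X.arr t i c ω * totalArr X t ω := by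
        refine Finset.sum_le_sum fun i _ => Finset.sum_le_sum fun c _ => ?_
        rw [sq]
        exact mul_le_mul_of_nonneg_left (arr_le_totalArr hA t i c ω) (hA.arr_nonneg t i c ω)
    _ = totalArr X t ω ^ 2 := by
        rw [sq]; nth_rw 2 [totalArr]; simp only [Finset.sum_mul]

theorem lyapunov_succ_le (hX : IsExecution net P F X) (hA : Admissible net lam P F X)
    (hR : RateBound net R) (t : ℕ) (ω : Ω) :
    lyapunov X (t + 1) ω ≤ lyapunov X t ω + 3 * R ^ 2 * (Fintype.card N : ℝ) ^ 2
      + 2 * totalArr X t ω ^ 2 + 2 * ∑ i, ∑ c, X.queue t i c ω * X.arr t i c ω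
      - 2 * ∑ i, ∑ j, ∑ c, X.offered t i j c ω * (X.queue t i c ω - X.queue t j c ω) := by
  -- One `R ^ 2` comes from the outgoing rate, two from `(inn + a) ^ 2 ≤ 2 * inn ^ 2 + 2 * a ^ 2`.
  have key : ∀ i c, X.queue (t + 1) i c ω ^ 2 ≤ X.queue t i c ω ^ 2 + 3 * R ^ 2
      + 2 * X.arr t i c ω ^ 2 + 2 * (X.queue t i c ω * X.arr t i c ω)
      - 2 * (X.queue t i c ω * (∑ j, X.offered t i j c ω - ∑ k, X.offered t k i c ω)) := by
    intro i c
    by_cases h : i = c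
    · subst h
      simp only [hX.queue_self]
      nlinarith [sq_nonneg R, sq_nonneg (X.arr t i i ω)]
    · have hin₀ : 0 ≤ ∑ k, X.offered t k i c ω :=
        Finset.sum_nonneg fun k _ => hX.offered_nonneg t k i c ω
      have hout₀ : 0 ≤ ∑ j, X.offered t i j c ω :=
        Finset.sum_nonneg fun k _ => hX.offered_nonneg t i k c ω
      have hin := pow_le_pow_left₀ hin₀ (sum_offered_in_le hX hR t i c ω) 2
      have hout := pow_le_pow_left₀ hout₀ (sum_offered_out_le hX hR t i c ω) 2
      have hstep := sq_queue_update_le (queue_nonneg hX hA t i c ω) hout₀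
        (sum_sent_in_nonneg hX t i c ω) (sum_sent_in_le hX t i c ω) (hA.arr_nonneg t i c ω)
      rw [hX.queue_succ t i c ω h, hX.sent_sum]
      nlinarith [sq_nonneg (∑ k, X.offered t k i c ω - X.arr t i c ω)]
  have hsum := Finset.sum_le_sum fun i (_ : i ∈ Finset.univ) =>
    Finset.sum_le_sum fun c (_ : c ∈ Finset.univ) => key i c
  have harr := sum_sq_arr_le hA t ω
  simp only [Finset.sum_add_distrib, Finset.sum_sub_distrib, ← Finset.mul_sum, Finset.sum_const,
    Finset.card_univ, nsmul_eq_mul] at hsum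
  rw [sum_mul_netFlow (fun i c => X.queue t i c ω) fun i j c => X.offered t i j c ω] at hsum
  simp only [lyapunov]
  nlinarith

theorem lyapunov_succ_le_of_isBPBias [DecidableEq N] {B : ℝ} (hB : 0 ≤ B)
    (hX : IsExecution net P F X)
    (hA : Admissible net lam P F X) (hR : RateBound net R)
    (hBP : IsBPBias net B Ω X) (t : ℕ) (ω : Ω) :
    lyapunov X (t + 1) ω ≤ lyapunov X t ω + (3 * R ^ 2 * (Fintype.card N : ℝ) ^ 2 + 4 * R * B)
      + 2 * totalArr X t ω ^ 2 + 2 * ∑ i, ∑ c, X.queue t i c ω * X.arr t i c ω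
      - 2 * maxWeight net (fun i c => X.queue t i c ω) (X.state t ω) := by
  obtain ⟨b, hb, -, hf⟩ := hBP
  have h := maxWeight_le_of_backpressureSlot hR hB (fun i c => hb t i c ω)
    (fun i j c => hX.offered_nonneg t i j c ω) (fun i j => hX.offered_le t i j ω) (hf t ω)
  linarith [lyapunov_succ_le hX hA hR t ω]

/-- Within a window, backlogs move by at most the total `D` of rates and arrivals. Replacing them by
their values at `t₀` costs terms quadratic in `D` and the arrivals, with no factor of the backlog.
The weights become known at time `t₀`, as conditioning on `F t₀` requires. -/
theorem lyapunov_window_le_of_isBPBias [DecidableEq N] [Finite Act] {B : ℝ} (hB : 0 ≤ B)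
    (hX : IsExecution net P F X) (hA : Admissible net lam P F X) (hR₀ : 0 ≤ R)
    (hR : RateBound net R) (hBP : IsBPBias net B Ω X) (K : ℕ) :
    ∃ C₁ C₂ : ℝ, ∀ t₀ ω, lyapunov X (t₀ + K) ω ≤ lyapunov X t₀ ω + C₁
      + C₂ * ∑ τ ∈ Finset.Ico t₀ (t₀ + K), totalArr X τ ω ^ 2
      + 2 * ∑ i, ∑ c, X.queue t₀ i c ω * ∑ τ ∈ Finset.Ico t₀ (t₀ + K), X.arr τ i c ω
      - 2 * ∑ τ ∈ Finset.Ico t₀ (t₀ + K),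
          maxWeight net (fun i c => X.queue t₀ i c ω) (X.state τ ω) := by
  set C₀ := 3 * R ^ 2 * (Fintype.card N : ℝ) ^ 2 + 4 * R * B with hC₀
  -- With `S` the arrivals of the window, the freezing errors `2 * D * S + 4 * K * R * D` are at
  -- most `2 * (K * R) ^ 2 + 4 * D ^ 2`. Then `D ^ 2 ≤ 2 * (K * R) ^ 2 + 2 * S ^ 2`, and
  -- Cauchy–Schwarz bounds `S ^ 2`.
  refine ⟨K * C₀ + 2 * (K * R) ^ 2 + 8 * (K * R) ^ 2, 2 + 8 * K, fun t₀ ω => ?_⟩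
  set D := ∑ r ∈ Finset.Ico t₀ (t₀ + K), (R + totalArr X r ω) with hD
  have hD₀ : 0 ≤ D := Finset.sum_nonneg fun r _ => add_nonneg hR₀ (totalArr_nonneg hA r ω)
  have hdiff := fun τ (hτ : τ ∈ Finset.Ico t₀ (t₀ + K)) i c =>
    abs_queue_sub_le_window hX hA hR₀ hR t₀ K hτ i c ω
  have hslot : ∀ τ ∈ Finset.Ico t₀ (t₀ + K), lyapunov X (τ + 1) ω - lyapunov X τ ω ≤
      C₀ + 2 * totalArr X τ ω ^ 2 + 2 * ∑ i, ∑ c, X.queue t₀ i c ω * X.arr τ i c ω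
      + 2 * (D * totalArr X τ ω)
      - 2 * maxWeight net (fun i c => X.queue t₀ i c ω) (X.state τ ω) + 4 * R * D := by
    intro τ hτ
    have h₁ := lyapunov_succ_le_of_isBPBias hB hX hA hR hBP τ ω
    have h₂ := maxWeight_le_add hR₀ hR (w := fun i c => X.queue t₀ i c ω)
      (w' := fun i c => X.queue τ i c ω) hD₀
      (fun i c => by rw [abs_sub_comm]; exact hdiff τ hτ i c) (X.state τ ω)
    have h₃ : ∑ i, ∑ c, X.queue τ i c ω * X.arr τ i c ω
        ≤ ∑ i, ∑ c, X.queue t₀ i c ω * X.arr τ i c ω + D * totalArr X τ ω := by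
      simp only [totalArr, Finset.mul_sum, ← Finset.sum_add_distrib, ← add_mul]
      refine Finset.sum_le_sum fun i _ => Finset.sum_le_sum fun c _ =>
        mul_le_mul_of_nonneg_right ?_ (hA.arr_nonneg τ i c ω)
      linarith [(abs_le.1 (hdiff τ hτ i c)).2]
    linarith
  have hsum := Finset.sum_le_sum hslot
  rw [Finset.sum_Ico_sub (fun t => lyapunov X t ω) (Nat.le_add_right _ _)] at hsum
  simp only [Finset.sum_add_distrib, Finset.sum_sub_distrib, ← Finset.mul_sum, Finset.sum_const,
    Nat.card_Ico, add_tsub_cancel_left, nsmul_eq_mul] at hsum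
  have hswap : ∑ τ ∈ Finset.Ico t₀ (t₀ + K), ∑ i, ∑ c, X.queue t₀ i c ω * X.arr τ i c ω
      = ∑ i, ∑ c, X.queue t₀ i c ω * ∑ τ ∈ Finset.Ico t₀ (t₀ + K), X.arr τ i c ω := by
    rw [Finset.sum_comm]
    refine Finset.sum_congr rfl fun i _ => ?_
    rw [Finset.sum_comm]
    simp only [Finset.mul_sum]
  rw [hswap] at hsum
  have hDeq : D = K * R + ∑ r ∈ Finset.Ico t₀ (t₀ + K), totalArr X r ω := by
    rw [hD, Finset.sum_add_distrib]; simp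
  have hcs : (∑ r ∈ Finset.Ico t₀ (t₀ + K), totalArr X r ω) ^ 2
      ≤ K * ∑ r ∈ Finset.Ico t₀ (t₀ + K), totalArr X r ω ^ 2 := by
    simpa using sq_sum_le_card_mul_sum_sq (s := Finset.Ico t₀ (t₀ + K))
      (f := fun r => totalArr X r ω)
  set S := ∑ r ∈ Finset.Ico t₀ (t₀ + K), totalArr X r ω with hS
  have hS₀ : 0 ≤ S := Finset.sum_nonneg fun r _ => totalArr_nonneg hA r ω
  have hKR : 0 ≤ (K : ℝ) * R := by positivity
  have h₁ : D * S ≤ D ^ 2 := by rw [sq]; exact mul_le_mul_of_nonneg_left (by linarith) hD₀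
  have h₂ : 2 * (K * R) * D ≤ (K * R) ^ 2 + D ^ 2 := by nlinarith [sq_nonneg (K * R - D)]
  have h₃ : D ^ 2 ≤ 2 * (K * R) ^ 2 + 2 * S ^ 2 := by
    rw [hDeq]; nlinarith [sq_nonneg (K * R - S)]
  nlinarith

end Pathwise

/-! ### Integrability, measurability and averaging over windows -/

section Moments

variable {Ω : Type*} [mΩ : MeasurableSpace Ω] {P : Measure Ω}

/-- If the conditional expectations of `Y s` are close to constants `l s`, then so are the
expectations weighted by variables `Z s` of the past. -/
theorem abs_integral_sum_mul_sub_le [IsFiniteMeasure P] {ι : Type*} [Fintype ι]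
    {m : MeasurableSpace Ω} (hm : m ≤ mΩ) {Z Y : ι → Ω → ℝ} {l : ι → ℝ} {M : Ω → ℝ} {δ : ℝ}
    (hZm : ∀ s, StronglyMeasurable[m] (Z s)) (hZ : ∀ s, Integrable (Z s) P)
    (hY : ∀ s, Integrable (Y s) P) (hZY : ∀ s, Integrable (fun ω => Z s ω * Y s ω) P)
    (hZM : ∀ s ω, |Z s ω| ≤ M ω) (hM₀ : ∀ ω, 0 ≤ M ω) (hM : Integrable M P)
    (h : ∀ᵐ ω ∂P, ∑ s, |(P[Y s | m]) ω - l s| ≤ δ) :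
    |∫ ω, ∑ s, Z s ω * Y s ω ∂P - ∑ s, l s * ∫ ω, Z s ω ∂P| ≤ δ * ∫ ω, M ω ∂P := by
  have hpull : ∀ s, P[fun ω => Z s ω * Y s ω | m] =ᵐ[P] fun ω => Z s ω * (P[Y s | m]) ω :=
    fun s => condExp_mul_of_stronglyMeasurable_left (hZm s) (hZY s) (hY s)
  have hint : ∀ s, Integrable (fun ω => Z s ω * (P[Y s | m]) ω) P :=
    fun s => integrable_condExp.congr (hpull s)
  have heq : ∫ ω, ∑ s, Z s ω * Y s ω ∂P - ∑ s, l s * ∫ ω, Z s ω ∂P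
      = ∫ ω, ∑ s, Z s ω * ((P[Y s | m]) ω - l s) ∂P := by
    simp only [mul_sub, Finset.sum_sub_distrib]
    rw [integral_sub (integrable_finsetSum _ fun s _ => hint s)
      (integrable_finsetSum _ fun s _ => (hZ s).mul_const _),
      integral_finsetSum _ fun s _ => hZY s, integral_finsetSum _ fun s _ => hint s,
      integral_finsetSum _ fun s _ => (hZ s).mul_const _]
    congr 1
    · exact Finset.sum_congr rfl fun s _ => by
        rw [← integral_congr_ae (hpull s), integral_condExp hm]
    · exact Finset.sum_congr rfl fun s _ => by rw [integral_mul_const, mul_comm]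
  rw [heq, ← integral_const_mul]
  refine abs_integral_le_integral_abs.trans (integral_mono_ae ?_ (hM.const_mul δ) ?_)
  · refine Integrable.abs (integrable_finsetSum _ fun s _ => ?_)
    simp only [mul_sub]
    exact (hint s).sub ((hZ s).mul_const _)
  · filter_upwards [h] with ω hω
    calc |∑ s, Z s ω * ((P[Y s | m]) ω - l s)|
        ≤ ∑ s, |Z s ω * ((P[Y s | m]) ω - l s)| := Finset.abs_sum_le_sum_abs _ _
      _ ≤ ∑ s, M ω * |(P[Y s | m]) ω - l s| := by
          refine Finset.sum_le_sum fun s _ => ?_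
          rw [abs_mul]
          exact mul_le_mul_of_nonneg_right (hZM s ω) (abs_nonneg _)
      _ = (∑ s, |(P[Y s | m]) ω - l s|) * M ω := by rw [← Finset.mul_sum, mul_comm]
      _ ≤ δ * M ω := mul_le_mul_of_nonneg_right hω (hM₀ ω)

variable {N St Act : Type*} [Fintype N] [Fintype St] [DecidableEq St]
variable {net : Network N St Act} {lam : N → N → ℝ} {F : Filtration ℕ mΩ}
variable {X : Trajectory N St Act Ω} {R : ℝ}

theorem arr_memLp (hA : Admissible net lam P F X) (t : ℕ) (i c : N) :
    MemLp (X.arr t i c) 2 P := by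
  obtain ⟨Amax, -, h⟩ := hA.second_moment
  have hm : AEStronglyMeasurable (X.arr t i c) P :=
    ((hA.arr_measurable t i c).mono (F.le _) le_rfl).aestronglyMeasurable
  rw [memLp_two_iff_integrable_sq hm]
  refine (h t i).1.mono' (hm.pow 2) (ae_of_all _ fun ω => ?_)
  rw [Real.norm_of_nonneg (sq_nonneg _)]
  exact pow_le_pow_left₀ (hA.arr_nonneg t i c ω)
    (Finset.single_le_sum (fun c _ => hA.arr_nonneg t i c ω) (Finset.mem_univ c)) 2

theorem totalArr_memLp (hA : Admissible net lam P F X) (t : ℕ) : MemLp (totalArr X t) 2 P :=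
  memLp_finsetSum _ fun i _ => memLp_finsetSum _ fun c _ => arr_memLp hA t i c

theorem exists_integral_sq_totalArr_le (hA : Admissible net lam P F X) :
    ∃ M, 0 ≤ M ∧ ∀ t, ∫ ω, totalArr X t ω ^ 2 ∂P ≤ M := by
  obtain ⟨Amax, -, h⟩ := hA.second_moment
  refine ⟨Fintype.card N * (Fintype.card N * Amax ^ 2), by positivity, fun t => ?_⟩
  have hle : ∀ ω, totalArr X t ω ^ 2
      ≤ (Fintype.card N : ℝ) * ∑ i, (∑ c, X.arr t i c ω) ^ 2 := fun ω => by
    simpa [totalArr] using sq_sum_le_card_mul_sum_sq (s := (Finset.univ : Finset N))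
      (f := fun i => ∑ c, X.arr t i c ω)
  refine (integral_mono (totalArr_memLp hA t).integrable_sq
    ((integrable_finsetSum _ fun i _ => (h t i).1).const_mul _) hle).trans ?_
  rw [integral_const_mul, integral_finsetSum _ fun i _ => (h t i).1]
  refine mul_le_mul_of_nonneg_left ?_ (by positivity)
  refine (Finset.sum_le_sum fun i _ => (h t i).2).trans ?_
  simp

theorem queue_measurable (hX : IsExecution net P F X) (hA : Admissible net lam P F X)
    (t : ℕ) (i c : N) : Measurable[F t] (X.queue t i c) := by
  induction t generalizing i with
  | zero => exact hX.queue_init_measurable i c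
  | succ t ih =>
    by_cases h : i = c
    · subst h
      rw [show X.queue (t + 1) i i = fun _ => 0 from funext fun ω => hX.queue_self _ _ ω]
      exact measurable_const
    · rw [show X.queue (t + 1) i c = fun ω => X.queue t i c ω - ∑ j, X.sent t i j c ω
          + ∑ k, X.sent t k i c ω + X.arr t i c ω from funext fun ω => hX.queue_succ t i c ω h]
      exact (((((ih i).mono (F.mono (Nat.le_succ t)) le_rfl)).sub
        (Finset.measurable_fun_sum _ fun j _ => hX.sent_measurable t i j c)).add
        (Finset.measurable_fun_sum _ fun k _ => hX.sent_measurable t k i c)).add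
        (hA.arr_measurable t i c)

theorem queue_measurable' (hX : IsExecution net P F X) (hA : Admissible net lam P F X)
    (t : ℕ) (i c : N) : Measurable (X.queue t i c) :=
  (queue_measurable hX hA t i c).mono (F.le t) le_rfl

theorem queue_memLp [IsFiniteMeasure P] (hX : IsExecution net P F X)
    (hA : Admissible net lam P F X) (hR₀ : 0 ≤ R) (hR : RateBound net R) (t : ℕ) (i c : N) :
    MemLp (X.queue t i c) 2 P := by
  induction t with
  | zero => exact hX.queue_init_memLp i c
  | succ t ih =>
    have hdom : MemLp (fun ω => X.queue t i c ω + (R + totalArr X t ω)) 2 P :=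
      ih.add ((memLp_const R).add (totalArr_memLp hA t))
    refine hdom.mono' (queue_measurable' hX hA _ i c).aestronglyMeasurable
      (ae_of_all _ fun ω => ?_)
    rw [Real.norm_of_nonneg (queue_nonneg hX hA _ i c ω)]
    linarith [(abs_le.1 (abs_queue_succ_sub_le hX hA hR₀ hR t i c ω)).2]

theorem queue_integrable [IsFiniteMeasure P] (hX : IsExecution net P F X)
    (hA : Admissible net lam P F X) (hR₀ : 0 ≤ R) (hR : RateBound net R) (t : ℕ) (i c : N) :
    Integrable (X.queue t i c) P :=
  (queue_memLp hX hA hR₀ hR t i c).integrable one_le_two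

theorem lyapunov_integrable [IsFiniteMeasure P] (hX : IsExecution net P F X)
    (hA : Admissible net lam P F X) (hR₀ : 0 ≤ R) (hR : RateBound net R) (t : ℕ) :
    Integrable (lyapunov X t) P :=
  integrable_finsetSum _ fun i _ => integrable_finsetSum _ fun c _ =>
    (queue_memLp hX hA hR₀ hR t i c).integrable_sq

theorem measurable_maxWeight_queue [Finite Act] (hX : IsExecution net P F X)
    (hA : Admissible net lam P F X) (t : ℕ) (s : St) :
    Measurable[F t] fun ω => maxWeight net (fun i c => X.queue t i c ω) s := by
  unfold maxWeight linkWeight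
  refine Measurable.iSup fun a => Finset.measurable_fun_sum _ fun i _ =>
    Finset.measurable_fun_sum _ fun j _ => Measurable.const_mul (Measurable.iSup fun c => ?_) _
  exact ((queue_measurable hX hA t i c).sub (queue_measurable hX hA t j c)).max measurable_const

/-- Decomposing over the finitely many states gives a sum of indicators, for which measurability of
the events `X.state τ = s` suffices. -/
theorem integrable_comp_state (hA : Admissible net lam P F X) {Z : St → Ω → ℝ}
    (hZ : ∀ s, Integrable (Z s) P) (τ : ℕ) : Integrable (fun ω => Z (X.state τ ω) ω) P := by
  have heq : (fun ω => Z (X.state τ ω) ω)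
      = fun ω => ∑ s, {ω' | X.state τ ω' = s}.indicator (Z s) ω := by
    funext ω
    simp [Set.indicator_apply]
  rw [heq]
  exact integrable_finsetSum _ fun s _ => (hZ s).indicator (F.le _ _ (hA.state_measurable τ s))

theorem abs_integral_mul_window_sub_le [IsFiniteMeasure P] {K : ℕ} (hK : 0 < K) {t₀ : ℕ}
    {m : MeasurableSpace Ω} (hm : m ≤ mΩ) {A : ℕ → Ω → ℝ} (hA : ∀ t, MemLp (A t) 2 P) {l δ : ℝ}
    (h : ∀ᵐ ω ∂P, |(P[fun ω' => (1 / (K : ℝ)) * ∑ τ ∈ Finset.Ico t₀ (t₀ + K), A τ ω' | m]) ω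
      - l| ≤ δ)
    {Z : Ω → ℝ} (hZm : StronglyMeasurable[m] Z) (hZ : MemLp Z 2 P) (hZ₀ : ∀ ω, 0 ≤ Z ω) :
    |∫ ω, Z ω * ∑ τ ∈ Finset.Ico t₀ (t₀ + K), A τ ω ∂P - K * l * ∫ ω, Z ω ∂P|
      ≤ K * δ * ∫ ω, Z ω ∂P := by
  have hK' : (0 : ℝ) < K := by exact_mod_cast hK
  have hYm : MemLp (fun ω' => (1 / (K : ℝ)) * ∑ τ ∈ Finset.Ico t₀ (t₀ + K), A τ ω') 2 P :=
    (memLp_finsetSum _ fun τ _ => hA τ).const_mul _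
  have key := abs_integral_sum_mul_sub_le (mΩ := mΩ) (ι := Unit) (P := P) hm (Z := fun _ => Z)
    (Y := fun _ ω' => (1 / (K : ℝ)) * ∑ τ ∈ Finset.Ico t₀ (t₀ + K), A τ ω')
    (l := fun _ => l) (M := Z) (δ := δ) (fun _ => hZm) (fun _ => hZ.integrable one_le_two)
    (fun _ => hYm.integrable one_le_two) (fun _ => hZ.integrable_mul hYm)
    (fun _ ω => (abs_of_nonneg (hZ₀ ω)).le) hZ₀ (hZ.integrable one_le_two) (by simpa using h)
  simp only [Finset.univ_unique, Finset.sum_singleton] at key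
  have hscale : ∫ ω, Z ω * ((1 / (K : ℝ)) * ∑ τ ∈ Finset.Ico t₀ (t₀ + K), A τ ω) ∂P
      = (1 / (K : ℝ)) * ∫ ω, Z ω * ∑ τ ∈ Finset.Ico t₀ (t₀ + K), A τ ω ∂P := by
    rw [← integral_const_mul]
    exact integral_congr_ae (ae_of_all _ fun ω => by ring)
  rw [hscale] at key
  have hmul := mul_le_mul_of_nonneg_left key hK'.le
  rw [← abs_of_pos hK', ← abs_mul, abs_of_pos hK', mul_sub, ← mul_assoc, ← mul_assoc,
    ← mul_assoc, mul_one_div_cancel hK'.ne', one_mul] at hmul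
  exact hmul

/-- The window sum is `∑ s, Z s` times the number of visits to `s`. Since admissibility bounds the
frequency errors summed over `s`, a common bound `M` of all `Z s` gives an error without a factor of
the number of states. -/
theorem abs_integral_state_window_sub_le [IsFiniteMeasure P] (hA : Admissible net lam P F X)
    {K : ℕ} (hK : 0 < K) {t₀ : ℕ} {δ : ℝ}
    (h : ∀ᵐ ω ∂P, ∑ s, |(P[fun ω' => (1 / (K : ℝ)) * ∑ τ ∈ Finset.Ico t₀ (t₀ + K),
          (if X.state τ ω' = s then (1 : ℝ) else 0) | F t₀]) ω - net.freq s| ≤ δ)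
    {Z : St → Ω → ℝ} {M : Ω → ℝ} (hZm : ∀ s, StronglyMeasurable[F t₀] (Z s))
    (hZ₀ : ∀ s ω, 0 ≤ Z s ω) (hZM : ∀ s ω, Z s ω ≤ M ω) (hM₀ : ∀ ω, 0 ≤ M ω)
    (hM : Integrable M P) :
    |∫ ω, ∑ τ ∈ Finset.Ico t₀ (t₀ + K), Z (X.state τ ω) ω ∂P
        - K * ∑ s, net.freq s * ∫ ω, Z s ω ∂P| ≤ K * δ * ∫ ω, M ω ∂P := by
  have hK' : (0 : ℝ) < K := by exact_mod_cast hK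
  have hZ : ∀ s, Integrable (Z s) P := fun s =>
    hM.mono' ((hZm s).mono (F.le t₀)).aestronglyMeasurable
      (ae_of_all _ fun ω => by rw [Real.norm_of_nonneg (hZ₀ s ω)]; exact hZM s ω)
  have hYm : ∀ s, Measurable fun ω' => (1 / (K : ℝ)) * ∑ τ ∈ Finset.Ico t₀ (t₀ + K),
      (if X.state τ ω' = s then (1 : ℝ) else 0) := fun s =>
    (Finset.measurable_fun_sum _ fun τ _ => Measurable.ite
      (F.le _ _ (hA.state_measurable τ s)) measurable_const measurable_const).const_mul _
  have hYb : ∀ s ω, ‖(1 / (K : ℝ)) * ∑ τ ∈ Finset.Ico t₀ (t₀ + K),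
      (if X.state τ ω = s then (1 : ℝ) else 0)‖ ≤ 1 := by
    intro s ω
    have h₀ : 0 ≤ ∑ τ ∈ Finset.Ico t₀ (t₀ + K), (if X.state τ ω = s then (1 : ℝ) else 0) :=
      Finset.sum_nonneg fun τ _ => by split_ifs <;> norm_num
    have h₁ : ∑ τ ∈ Finset.Ico t₀ (t₀ + K), (if X.state τ ω = s then (1 : ℝ) else 0) ≤ K := by
      refine (Finset.sum_le_sum (g := fun _ => (1 : ℝ)) fun τ _ => ?_).trans (by simp)
      split_ifs <;> norm_num
    rw [Real.norm_of_nonneg (by positivity), one_div, inv_mul_le_iff₀ hK', mul_one]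
    exact h₁
  have key := abs_integral_sum_mul_sub_le (P := P) (F.le t₀) (Z := Z)
    (Y := fun s ω' => (1 / (K : ℝ)) * ∑ τ ∈ Finset.Ico t₀ (t₀ + K),
      (if X.state τ ω' = s then (1 : ℝ) else 0))
    (l := net.freq) (M := M) (δ := δ) hZm hZ
    (fun s => (integrable_const (1 : ℝ)).mono' (hYm s).aestronglyMeasurable
      (ae_of_all _ (hYb s)))
    (fun s => (hZ s).mul_bdd (c := 1) (hYm s).aestronglyMeasurable (ae_of_all _ (hYb s)))
    (fun s ω => by rw [abs_of_nonneg (hZ₀ s ω)]; exact hZM s ω) hM₀ hM h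
  have hscale : ∫ ω, ∑ s, Z s ω * ((1 / (K : ℝ)) * ∑ τ ∈ Finset.Ico t₀ (t₀ + K),
      (if X.state τ ω = s then (1 : ℝ) else 0)) ∂P
      = (1 / (K : ℝ)) * ∫ ω, ∑ τ ∈ Finset.Ico t₀ (t₀ + K), Z (X.state τ ω) ω ∂P := by
    rw [← integral_const_mul]
    refine integral_congr_ae (ae_of_all _ fun ω => ?_)
    simp only [Finset.mul_sum]
    rw [Finset.sum_comm]
    refine Finset.sum_congr rfl fun τ _ => ?_
    rw [Finset.sum_eq_single (X.state τ ω)]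
    · simp only [if_true]; ring
    · intro s _ hs; simp [hs.symm]
    · simp
  rw [hscale] at key
  have hmul := mul_le_mul_of_nonneg_left key hK'.le
  rw [← abs_of_pos hK', ← abs_mul, abs_of_pos hK', mul_sub, ← mul_assoc, ← mul_assoc,
    mul_one_div_cancel hK'.ne', one_mul] at hmul
  exact hmul

end Moments

/-! ### Overflow averages and their relation to means -/

section Overflow

variable {Ω : Type*} [mΩ : MeasurableSpace Ω] {P : Measure Ω}

theorem overflow_average_nonneg (q : ℕ → Ω → ℝ) (V : ℝ) (T : ℕ) :
    0 ≤ ∫ ω, (1 / (T : ℝ)) * ∑ τ ∈ Finset.range T, (if V < q τ ω then (1 : ℝ) else 0) ∂P :=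
  integral_nonneg fun ω => mul_nonneg (by positivity)
    (Finset.sum_nonneg fun τ _ => by split_ifs <;> norm_num)

variable [IsProbabilityMeasure P]

theorem integrable_overflow_indicator {q : Ω → ℝ} (hq : Measurable q) (V : ℝ) :
    Integrable (fun ω => if V < q ω then (1 : ℝ) else 0) P := by
  refine (integrable_const (1 : ℝ)).mono' (Measurable.ite (measurableSet_lt measurable_const hq)
    measurable_const measurable_const).aestronglyMeasurable (ae_of_all _ fun ω => ?_)
  split_ifs <;> simp

theorem integral_overflow_average {q : ℕ → Ω → ℝ} (hq : ∀ t, Measurable (q t)) (V : ℝ) (T : ℕ) :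
    ∫ ω, (1 / (T : ℝ)) * ∑ τ ∈ Finset.range T, (if V < q τ ω then (1 : ℝ) else 0) ∂P
      = (1 / (T : ℝ)) * ∑ τ ∈ Finset.range T, ∫ ω, (if V < q τ ω then (1 : ℝ) else 0) ∂P := by
  rw [integral_const_mul, integral_finsetSum _ fun τ _ => integrable_overflow_indicator (hq τ) V]

theorem overflow_average_le_one {q : ℕ → Ω → ℝ} (hq : ∀ t, Measurable (q t)) (V : ℝ) (T : ℕ) :
    ∫ ω, (1 / (T : ℝ)) * ∑ τ ∈ Finset.range T, (if V < q τ ω then (1 : ℝ) else 0) ∂P ≤ 1 := by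
  rw [integral_overflow_average hq]
  have h : ∀ τ, ∫ ω, (if V < q τ ω then (1 : ℝ) else 0) ∂P ≤ 1 := fun τ => by
    refine (integral_mono (integrable_overflow_indicator (hq τ) V) (integrable_const (1 : ℝ))
      fun ω => ?_).trans (by simp)
    dsimp only
    split_ifs <;> norm_num
  calc (1 / (T : ℝ)) * ∑ τ ∈ Finset.range T, ∫ ω, (if V < q τ ω then (1 : ℝ) else 0) ∂P
      ≤ (1 / (T : ℝ)) * ∑ τ ∈ Finset.range T, 1 :=
        mul_le_mul_of_nonneg_left (Finset.sum_le_sum fun τ _ => h τ) (by positivity)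
    _ ≤ 1 := by
        simp only [Finset.sum_const, Finset.card_range, nsmul_eq_mul, mul_one, one_div]
        -- Only an inequality, since the average over `T = 0` slots is `0` by the convention for
        -- division by zero.
        exact inv_mul_le_one

theorem eventually_overflow_average_lt {q : ℕ → Ω → ℝ} (hq : ∀ t, Measurable (q t)) {V κ : ℝ}
    (h : overflow P q V < κ) :
    ∀ᶠ T : ℕ in atTop,
      (1 / (T : ℝ)) * ∑ τ ∈ Finset.range T, ∫ ω, (if V < q τ ω then (1 : ℝ) else 0) ∂P < κ := by
  have := eventually_lt_of_limsup_lt h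
    (isBoundedUnder_of ⟨1, fun T => overflow_average_le_one hq V T⟩)
  simpa only [integral_overflow_average hq] using this

theorem overflow_nonneg {q : ℕ → Ω → ℝ} (hq : ∀ t, Measurable (q t)) (V : ℝ) :
    0 ≤ overflow P q V :=
  le_limsup_of_frequently_le (Frequently.of_forall fun T => overflow_average_nonneg q V T)
    (isBoundedUnder_of ⟨1, fun T => overflow_average_le_one hq V T⟩)

theorem tendsto_overflow_of_sum_integral_le {q : ℕ → Ω → ℝ} (hq : ∀ t, Measurable (q t))
    (hq₀ : ∀ t ω, 0 ≤ q t ω) (hqi : ∀ t, Integrable (q t) P) {C : ℝ}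
    (h : ∀ T : ℕ, ∑ τ ∈ Finset.range T, ∫ ω, q τ ω ∂P ≤ C * T + C) :
    Tendsto (overflow P q) atTop (𝓝 0) := by
  -- The instance `T = 0`; for `T ≥ 1` it yields `C * T + C ≤ 2 * C * T`, whence the `2 * C / V`
  -- below.
  have hC : 0 ≤ C := by simpa using h 0
  have hle : ∀ V : ℝ, 0 < V → overflow P q V ≤ 2 * C / V := by
    intro V hV
    refine limsup_le_of_le (isCoboundedUnder_le_of_le atTop
      (x := 0) fun T => overflow_average_nonneg q V T) ?_
    filter_upwards [eventually_ge_atTop 1] with T hT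
    have hT' : (1 : ℝ) ≤ T := by exact_mod_cast hT
    rw [integral_overflow_average hq]
    have hmarkov : ∀ τ, ∫ ω, (if V < q τ ω then (1 : ℝ) else 0) ∂P ≤ (∫ ω, q τ ω ∂P) / V := by
      intro τ
      rw [← integral_div]
      refine integral_mono (integrable_overflow_indicator (hq τ) V) ((hqi τ).div_const V)
        fun ω => ?_
      dsimp only
      split_ifs with hlt
      · rw [le_div_iff₀ hV]; linarith
      · exact div_nonneg (hq₀ τ ω) hV.le
    calc (1 / (T : ℝ)) * ∑ τ ∈ Finset.range T, ∫ ω, (if V < q τ ω then (1 : ℝ) else 0) ∂P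
        ≤ (1 / (T : ℝ)) * ∑ τ ∈ Finset.range T, (∫ ω, q τ ω ∂P) / V :=
          mul_le_mul_of_nonneg_left (Finset.sum_le_sum fun τ _ => hmarkov τ) (by positivity)
      _ = (∑ τ ∈ Finset.range T, ∫ ω, q τ ω ∂P) / T / V := by
          rw [← Finset.sum_div]; ring
      _ ≤ 2 * C / V := by
          refine div_le_div_of_nonneg_right ?_ hV.le
          rw [div_le_iff₀ (by linarith)]
          nlinarith [h T]
  refine tendsto_of_tendsto_of_tendsto_of_le_of_le' tendsto_const_nhds
    (tendsto_const_nhds.div_atTop tendsto_id : Tendsto (fun V : ℝ => 2 * C / V) atTop (𝓝 0))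
    (Eventually.of_forall fun V => overflow_nonneg hq V) ?_
  filter_upwards [eventually_gt_atTop 0] with V hV using hle V hV

/-- The mean of a variable with small overflow probability is small compared to the scale `T` of
its second moment. -/
theorem integral_le_of_overflow {q : Ω → ℝ} (hq : Measurable q) (hq₂ : MemLp q 2 P) {V T θ : ℝ}
    (hV : 0 ≤ V) (hT : 0 < T) (hθ : 0 < θ) :
    ∫ ω, q ω ∂P ≤ V + θ / T * ∫ ω, q ω ^ 2 ∂P
      + T / (4 * θ) * ∫ ω, (if V < q ω then (1 : ℝ) else 0) ∂P := by
  have hle : ∀ ω, q ω ≤ V + θ / T * q ω ^ 2 + T / (4 * θ) * (if V < q ω then (1 : ℝ) else 0) := by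
    intro ω
    split_ifs with h
    -- On the overflow event, completing the square trades `q` for its second moment and the
    -- constant `T / (4 * θ)`.
    · have : θ / T * q ω ^ 2 + T / (4 * θ) - q ω = θ / T * (q ω - T / (2 * θ)) ^ 2 := by
        field_simp; ring
      have h' : 0 ≤ θ / T * (q ω - T / (2 * θ)) ^ 2 := by positivity
      linarith
    · have h' : 0 ≤ θ / T * q ω ^ 2 := by positivity
      linarith
  have hi₂ : Integrable (fun ω => θ / T * q ω ^ 2) P := hq₂.integrable_sq.const_mul _
  have hi₃ := (integrable_overflow_indicator (P := P) hq V).const_mul (T / (4 * θ))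
  refine (integral_mono (hq₂.integrable one_le_two) (((integrable_const V).add hi₂).add hi₃)
    hle).trans_eq ?_
  rw [integral_add' ((integrable_const V).add hi₂) hi₃, integral_add' (integrable_const V) hi₂,
    integral_const_mul, integral_const_mul]
  simp

end Overflow

/-! ### Necessity: inequalities satisfied on the stability region -/

section Necessity

variable {Ω : Type*} [mΩ : MeasurableSpace Ω] {P : Measure Ω} [IsProbabilityMeasure P]
variable {N St Act : Type*} [Fintype N] [Fintype St] [DecidableEq St]
variable {net : Network N St Act} {lam : N → N → ℝ} {F : Filtration ℕ mΩ}
variable {X : Trajectory N St Act Ω} {R : ℝ}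

/-- A backlog is at most its initial value plus the rates and arrivals so far, and arrivals have
uniformly bounded second moments. This is the control that lets rare overflow restrain the means. -/
theorem exists_integral_sq_queue_le (hX : IsExecution net P F X) (hA : Admissible net lam P F X)
    (hR₀ : 0 ≤ R) (hR : RateBound net R) :
    ∃ C, 0 ≤ C ∧ ∀ t i c, ∫ ω, X.queue t i c ω ^ 2 ∂P ≤ C * ((t : ℝ) + 1) ^ 2 := by
  obtain ⟨M, hM₀, hM⟩ := exists_integral_sq_totalArr_le hA
  have hq₀ : ∀ i c, 0 ≤ ∫ ω, X.queue 0 i c ω ^ 2 ∂P := fun i c =>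
    integral_nonneg fun ω => sq_nonneg _
  set Q := ∑ i, ∑ c, ∫ ω, X.queue 0 i c ω ^ 2 ∂P with hQ
  have hQ₀ : 0 ≤ Q := Finset.sum_nonneg fun i _ => Finset.sum_nonneg fun c _ => hq₀ i c
  refine ⟨3 * (Q + R ^ 2 + M), by positivity, fun t i c => ?_⟩
  have hle : ∀ ω, X.queue t i c ω ^ 2 ≤ 3 * X.queue 0 i c ω ^ 2 + 3 * (t * R) ^ 2
      + 3 * t * ∑ r ∈ Finset.range t, totalArr X r ω ^ 2 := by
    intro ω
    have h₁ := (abs_le.1 (abs_queue_sub_le hX hA hR₀ hR 0 t i c ω)).2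
    rw [Finset.sum_add_distrib, zero_add, ← Finset.range_eq_Ico] at h₁
    simp only [Finset.sum_const, Finset.card_range, nsmul_eq_mul] at h₁
    have hcs : (∑ r ∈ Finset.range t, totalArr X r ω) ^ 2
        ≤ t * ∑ r ∈ Finset.range t, totalArr X r ω ^ 2 := by
      simpa using sq_sum_le_card_mul_sum_sq (s := Finset.range t) (f := fun r => totalArr X r ω)
    set S := ∑ r ∈ Finset.range t, totalArr X r ω
    have h₂ := pow_le_pow_left₀ (queue_nonneg hX hA t i c ω)
      (show X.queue t i c ω ≤ X.queue 0 i c ω + t * R + S by linarith) 2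
    nlinarith [sq_nonneg (X.queue 0 i c ω - t * R), sq_nonneg (X.queue 0 i c ω - S),
      sq_nonneg (t * R - S)]
  have hi₁ : Integrable (fun ω => 3 * X.queue 0 i c ω ^ 2) P :=
    (hX.queue_init_memLp i c).integrable_sq.const_mul 3
  have hi₂ : Integrable (fun _ : Ω => 3 * ((t : ℝ) * R) ^ 2) P := integrable_const _
  have hi₃ : Integrable (fun ω => 3 * (t : ℝ) * ∑ r ∈ Finset.range t, totalArr X r ω ^ 2) P :=
    (integrable_finsetSum _ fun r _ => (totalArr_memLp hA r).integrable_sq).const_mul _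
  refine (integral_mono (queue_memLp hX hA hR₀ hR t i c).integrable_sq ((hi₁.add hi₂).add hi₃)
    hle).trans ?_
  rw [integral_add' (hi₁.add hi₂) hi₃, integral_add' hi₁ hi₂, integral_const_mul,
    integral_const_mul (3 * (t : ℝ)),
    integral_finsetSum _ fun r _ => (totalArr_memLp hA r).integrable_sq]
  have h₁ : ∑ r ∈ Finset.range t, ∫ ω, totalArr X r ω ^ 2 ∂P ≤ t * M :=
    (Finset.sum_le_sum fun r _ => hM r).trans (by simp)
  have h₂ : ∫ ω, X.queue 0 i c ω ^ 2 ∂P ≤ Q := le_sum_sum hq₀ i c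
  have h₃ : (t : ℝ) * ∑ r ∈ Finset.range t, ∫ ω, totalArr X r ω ^ 2 ∂P ≤ t * (t * M) :=
    mul_le_mul_of_nonneg_left h₁ (by positivity)
  have ht : (0 : ℝ) ≤ t := by positivity
  have h₄ : ∫ _ω : Ω, 3 * ((t : ℝ) * R) ^ 2 ∂P = 3 * ((t : ℝ) * R) ^ 2 := by simp
  rw [h₄]
  nlinarith [mul_nonneg ht hM₀, mul_nonneg ht (sq_nonneg R), mul_nonneg ht hQ₀,
    mul_nonneg (mul_nonneg ht ht) hQ₀]

/-- If the arrivals exceed what can be transported in the direction `w`, then the backlogs grow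
linearly in mean. -/
theorem exists_linear_growth [Finite Act] (hX : IsExecution net P F X)
    (hA : Admissible net lam P F X) {w : N → N → ℝ} (hw : ∀ i c, 0 ≤ w i c)
    (hw' : ∀ c, w c c = 0)
    (hgap : ∑ s, net.freq s * maxWeight net w s < ∑ i, ∑ c, w i c * lam i c) :
    ∃ η > 0, ∃ K : ℕ, ∀ t : ℕ,
      η * ((t : ℝ) - K) ≤ ∑ i, ∑ c, w i c * ∫ ω, X.queue t i c ω ∂P := by
  obtain ⟨R, hR₀, hR⟩ := exists_rateBound net
  set g := ∑ i, ∑ c, w i c * lam i c - ∑ s, net.freq s * maxWeight net w s with hg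
  have hg₀ : 0 < g := sub_pos.2 hgap
  set S := ∑ i, ∑ c, w i c with hS
  have hS₀ : 0 ≤ S := Finset.sum_nonneg fun i _ => Finset.sum_nonneg fun c _ => hw i c
  -- The errors from arrivals (`δ * S`) and states (`δ * R * S`) then consume at most half of the
  -- gap; the `+ 1` covers `S = 0`.
  set δ := g / (2 * (S + R * S + 1)) with hδ
  have hδ₀ : 0 < δ := by positivity
  have hδS : δ * (S + R * S) ≤ g / 2 := by
    rw [hδ, div_mul_eq_mul_div, div_le_iff₀ (by positivity)]
    nlinarith [mul_nonneg hR₀ hS₀]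
  obtain ⟨K, hK, hconv⟩ := hA.convergence δ hδ₀
  have hqi := queue_integrable hX hA hR₀ hR
  have hsum : ∀ t, ∑ i, ∑ c, w i c * ∫ ω, X.queue t i c ω ∂P
      = ∫ ω, ∑ i, ∑ c, w i c * X.queue t i c ω ∂P := by
    intro t
    rw [integral_finsetSum _ fun i _ => integrable_finsetSum _ fun c _ => (hqi t i c).const_mul _]
    refine Finset.sum_congr rfl fun i _ => ?_
    rw [integral_finsetSum _ fun c _ => (hqi t i c).const_mul _]
    simp only [integral_const_mul]
  have hwindow : ∀ t₀, ∑ i, ∑ c, w i c * ∫ ω, X.queue t₀ i c ω ∂P + K * (g / 2)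
      ≤ ∑ i, ∑ c, w i c * ∫ ω, X.queue (t₀ + K) i c ω ∂P := by
    intro t₀
    have harr : ∀ i c, K * (w i c * lam i c) - K * δ * w i c
        ≤ ∫ ω, w i c * ∑ τ ∈ Finset.Ico t₀ (t₀ + K), X.arr τ i c ω ∂P := by
      intro i c
      have := abs_integral_mul_window_sub_le hK (F.le t₀) (fun t => arr_memLp hA t i c)
        ((hconv t₀).1 i c) (Z := fun _ => w i c) stronglyMeasurable_const (memLp_const _)
        (fun _ => hw i c)
      simp only [integral_const, probReal_univ, one_smul] at this
      linarith [(abs_le.1 this).1]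
    have hst : ∫ ω, ∑ τ ∈ Finset.Ico t₀ (t₀ + K), maxWeight net w (X.state τ ω) ∂P
        ≤ K * ∑ s, net.freq s * maxWeight net w s + K * δ * (R * S) := by
      have := abs_integral_state_window_sub_le hA hK (hconv t₀).2
        (Z := fun s _ => maxWeight net w s) (M := fun _ => R * S)
        (fun _ => stronglyMeasurable_const) (fun s _ => maxWeight_nonneg net w s)
        (fun s _ => maxWeight_le_mul_sum hR₀ hR hw s) (fun _ => by positivity)
        (integrable_const _)
      simp only [integral_const, probReal_univ, one_smul] at this
      linarith [(abs_le.1 this).2]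
    have hi₁ : Integrable (fun ω => ∑ i, ∑ c, w i c * X.queue t₀ i c ω) P :=
      integrable_finsetSum _ fun i _ => integrable_finsetSum _ fun c _ =>
        (hqi t₀ i c).const_mul _
    have hia : ∀ i c, Integrable
        (fun ω => w i c * ∑ τ ∈ Finset.Ico t₀ (t₀ + K), X.arr τ i c ω) P := fun i c =>
      (integrable_finsetSum _ fun τ _ => (arr_memLp hA τ i c).integrable one_le_two).const_mul _
    have hi₂ : Integrable
        (fun ω => ∑ i, ∑ c, w i c * ∑ τ ∈ Finset.Ico t₀ (t₀ + K), X.arr τ i c ω) P :=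
      integrable_finsetSum _ fun i _ => integrable_finsetSum _ fun c _ => hia i c
    have hi₃ : Integrable
        (fun ω => ∑ τ ∈ Finset.Ico t₀ (t₀ + K), maxWeight net w (X.state τ ω)) P :=
      integrable_finsetSum _ fun τ _ => integrable_comp_state hA
        (fun s => integrable_const (maxWeight net w s)) τ
    have hmono := integral_mono ((hi₁.add hi₂).sub hi₃)
      (integrable_finsetSum _ fun i _ => integrable_finsetSum _ fun c _ =>
        (hqi (t₀ + K) i c).const_mul (w i c))
      (fun ω => sum_mul_queue_window_ge hX hw' t₀ K ω)
    rw [integral_sub' (hi₁.add hi₂) hi₃, integral_add' hi₁ hi₂, ← hsum, ← hsum,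
      integral_finsetSum _ fun i _ => integrable_finsetSum _ fun c _ => hia i c,
      Finset.sum_congr rfl fun i _ => integral_finsetSum _ fun c _ => hia i c] at hmono
    have harr' := Finset.sum_le_sum fun i (_ : i ∈ Finset.univ) =>
      Finset.sum_le_sum fun c (_ : c ∈ Finset.univ) => harr i c
    simp only [Finset.sum_sub_distrib, ← Finset.mul_sum] at harr'
    have hKδ : (K : ℝ) * (δ * (S + R * S)) ≤ K * (g / 2) :=
      mul_le_mul_of_nonneg_left hδS (by positivity)
    nlinarith
  have hiter : ∀ r m : ℕ, (m : ℝ) * (K * (g / 2))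
      ≤ ∑ i, ∑ c, w i c * ∫ ω, X.queue (r + K * m) i c ω ∂P := by
    intro r m
    induction m with
    | zero =>
      simp only [Nat.cast_zero, zero_mul]
      exact Finset.sum_nonneg fun i _ => Finset.sum_nonneg fun c _ =>
        mul_nonneg (hw i c) (integral_nonneg fun ω => queue_nonneg hX hA _ i c ω)
    | succ m ih =>
      have := hwindow (r + K * m)
      rw [show r + K * (m + 1) = r + K * m + K by ring]
      push_cast
      linarith
  refine ⟨g / 2, by positivity, K, fun t => ?_⟩
  -- Windows are chained backwards from `t` down to its residue modulo `K`, where nonnegativity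
  -- starts the induction.
  have h := hiter (t % K) (t / K)
  rw [Nat.mod_add_div] at h
  refine le_trans ?_ h
  have hmod : (t : ℝ) = (t % K : ℕ) + K * (t / K : ℕ) := by
    exact_mod_cast (Nat.mod_add_div t K).symm
  have hlt : ((t % K : ℕ) : ℝ) ≤ K := by exact_mod_cast (Nat.mod_lt t hK).le
  nlinarith

theorem sum_range_cast (T : ℕ) : ∑ t ∈ Finset.range T, (t : ℝ) = T * (T - 1) / 2 := by
  induction T with
  | zero => simp
  | succ T ih => rw [Finset.sum_range_succ, ih]; push_cast; ring

/-- In a stable network the arrivals do not exceed what can be transported in any direction. -/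
theorem le_maxWeight_of_stable [Finite Act] (hX : IsExecution net P F X)
    (hA : Admissible net lam P F X) (hS : Stable P X) {w : N → N → ℝ}
    (hw : ∀ i c, 0 ≤ w i c) (hw' : ∀ c, w c c = 0) :
    ∑ i, ∑ c, w i c * lam i c ≤ ∑ s, net.freq s * maxWeight net w s := by
  by_contra! hgap
  obtain ⟨η, hη, K, hgrow⟩ := exists_linear_growth hX hA hw hw' hgap
  obtain ⟨R, hR₀, hR⟩ := exists_rateBound net
  obtain ⟨C, hC₀, hC⟩ := exists_integral_sq_queue_le hX hA hR₀ hR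
  set W := ∑ i, ∑ c, w i c with hW
  have hW₀ : 0 ≤ W := Finset.sum_nonneg fun i _ => Finset.sum_nonneg fun c _ => hw i c
  -- Summed over `t < T`, linear growth contributes about `η * T ^ 2 / 2`. The choices of `θ` and
  -- then `κ` make the second-moment and overflow terms at most `η * T ^ 2 / 8` each, so a large `T`
  -- gives a contradiction.
  set θ := η / (8 * (C * W + 1)) with hθ
  have hθ₀ : 0 < θ := by positivity
  have hθC : θ * C * W ≤ η / 8 := by
    rw [hθ, div_mul_eq_mul_div, div_mul_eq_mul_div, div_le_iff₀ (by positivity)]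
    nlinarith
  set κ := θ * η / (2 * (W + 1)) with hκ
  have hκ₀ : 0 < κ := by positivity
  have hκW : W * κ ≤ θ * η / 2 := by
    rw [hκ, mul_div_assoc', div_le_iff₀ (by positivity)]
    nlinarith [mul_pos hθ₀ hη]
  have hqm := fun i c t => queue_measurable' hX hA t i c
  have hV : ∀ᶠ V in atTop, ∀ i c, overflow P (fun t => X.queue t i c) V < κ :=
    eventually_all.2 fun i => eventually_all.2 fun c => (hS i c).eventually_lt_const hκ₀
  obtain ⟨V, hV, hV₀⟩ := (hV.and (eventually_ge_atTop 0)).exists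
  have hT : ∀ᶠ T : ℕ in atTop, ∀ i c, (1 / (T : ℝ)) * ∑ τ ∈ Finset.range T,
      ∫ ω, (if V < X.queue τ i c ω then (1 : ℝ) else 0) ∂P < κ :=
    eventually_all.2 fun i => eventually_all.2 fun c =>
      eventually_overflow_average_lt (hqm i c) (hV i c)
  obtain ⟨T, ⟨hT, hTbig⟩, hT₀⟩ := ((hT.and (tendsto_natCast_atTop_atTop.eventually_gt_atTop
    ((W * V + η * (1 / 2 + K)) / (η / 4)))).and (eventually_gt_atTop 0)).exists
  have hTpos : (0 : ℝ) < T := by exact_mod_cast hT₀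
  have hslot : ∀ t ∈ Finset.range T, η * ((t : ℝ) - K) ≤ W * V + θ * C * T * W
      + T / (4 * θ) * ∑ i, ∑ c, w i c *
        ∫ ω, (if V < X.queue t i c ω then (1 : ℝ) else 0) ∂P := by
    intro t ht
    have htT : (t : ℝ) + 1 ≤ T := by exact_mod_cast Finset.mem_range.1 ht
    refine (hgrow t).trans ?_
    have hone : ∀ i c, ∫ ω, X.queue t i c ω ∂P ≤ V + θ * C * T
        + T / (4 * θ) * ∫ ω, (if V < X.queue t i c ω then (1 : ℝ) else 0) ∂P := by
      intro i c
      have h₁ := integral_le_of_overflow (hqm i c t) (queue_memLp hX hA hR₀ hR t i c)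
        hV₀ hTpos hθ₀
      have h₂ : ∫ ω, X.queue t i c ω ^ 2 ∂P ≤ C * T ^ 2 := (hC t i c).trans
        (mul_le_mul_of_nonneg_left (pow_le_pow_left₀ (by positivity) htT 2) hC₀)
      have h₃ : θ / T * ∫ ω, X.queue t i c ω ^ 2 ∂P ≤ θ * C * T :=
        (mul_le_mul_of_nonneg_left h₂ (by positivity)).trans_eq (by field_simp)
      linarith
    calc ∑ i, ∑ c, w i c * ∫ ω, X.queue t i c ω ∂P
        ≤ ∑ i, ∑ c, (w i c * V + w i c * (θ * C * T) + T / (4 * θ) * (w i c *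
          ∫ ω, (if V < X.queue t i c ω then (1 : ℝ) else 0) ∂P)) := by
          refine Finset.sum_le_sum fun i _ => Finset.sum_le_sum fun c _ => ?_
          refine (mul_le_mul_of_nonneg_left (hone i c) (hw i c)).trans_eq (by ring)
      _ = _ := by
          simp only [Finset.sum_add_distrib, ← Finset.mul_sum, ← Finset.sum_mul]
          ring
  have hsum := Finset.sum_le_sum hslot
  have hprob : ∑ t ∈ Finset.range T, ∑ i, ∑ c, w i c *
      ∫ ω, (if V < X.queue t i c ω then (1 : ℝ) else 0) ∂P ≤ T * (W * κ) := by
    rw [Finset.sum_comm, hW, Finset.sum_mul, Finset.mul_sum]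
    refine Finset.sum_le_sum fun i _ => ?_
    rw [Finset.sum_comm, Finset.sum_mul, Finset.mul_sum]
    refine Finset.sum_le_sum fun c _ => ?_
    rw [← Finset.mul_sum]
    have := (hT i c).le
    rw [one_div, inv_mul_le_iff₀ hTpos] at this
    exact (mul_le_mul_of_nonneg_left this (hw i c)).trans_eq (by ring)
  simp only [Finset.sum_add_distrib, Finset.sum_sub_distrib, ← Finset.mul_sum, Finset.sum_const,
    Finset.card_range, nsmul_eq_mul, sum_range_cast] at hsum
  have hprob' : T / (4 * θ) * ∑ t ∈ Finset.range T, ∑ i, ∑ c, w i c *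
      ∫ ω, (if V < X.queue t i c ω then (1 : ℝ) else 0) ∂P ≤ T * (T * (η / 8)) := by
    refine (mul_le_mul_of_nonneg_left (hprob.trans (mul_le_mul_of_nonneg_left hκW hTpos.le))
      (by positivity)).trans_eq ?_
    field_simp; ring
  rw [div_lt_iff₀ (by positivity)] at hTbig
  have hfin : (T : ℝ) * (η * ((T - 1) / 2 - K)) ≤ T * (W * V + T * (η / 8) + T * (η / 8)) := by
    have := mul_le_mul_of_nonneg_left hθC (mul_nonneg hTpos.le hTpos.le)
    nlinarith
  have := le_of_mul_le_mul_left hfin hTpos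
  linarith

/-- For fixed `w` the inequality defines a closed set of rates, so it passes from supported rates to
their closure. -/
theorem le_maxWeight_of_mem_stabilityRegion [Finite Act]
    (hlam : lam ∈ stabilityRegion net) {w : N → N → ℝ}
    (hw : ∀ i c, 0 ≤ w i c) (hw' : ∀ c, w c c = 0) :
    ∑ i, ∑ c, w i c * lam i c ≤ ∑ s, net.freq s * maxWeight net w s := by
  have hclosed : IsClosed {lam : N → N → ℝ |
      ∑ i, ∑ c, w i c * lam i c ≤ ∑ s, net.freq s * maxWeight net w s} :=
    isClosed_le (by fun_prop) continuous_const
  refine closure_minimal ?_ hclosed hlam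
  rintro lam' ⟨Ω', mΩ', P', F', X', hP', hA', hX', hS'⟩
  exact le_maxWeight_of_stable hX' hA' hS' hw hw'

end Necessity

/-! ### Sufficiency: negative drift implies stability -/

section Sufficiency

variable {Ω : Type*} [mΩ : MeasurableSpace Ω] {P : Measure Ω}
variable {N St Act : Type*} [Fintype N] [DecidableEq N] [Fintype St] [DecidableEq St]
variable {net : Network N St Act} {lam : N → N → ℝ} {F : Filtration ℕ mΩ}
variable {X : Trajectory N St Act Ω} {R B ε : ℝ}

/-- The necessary condition is applied with the backlogs themselves as `w`. Diagonal rates, which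
receive no slack, are harmless because the diagonal backlogs vanish. -/
theorem queue_weight_le [Finite Act] (hX : IsExecution net P F X)
    (hA : Admissible net lam P F X)
    (hlam : (fun i c => if i = c then lam i c else lam i c + ε) ∈ stabilityRegion net)
    (t : ℕ) (ω : Ω) :
    ∑ i, ∑ c, lam i c * X.queue t i c ω + ε * ∑ i, ∑ c, X.queue t i c ω
      ≤ ∑ s, net.freq s * maxWeight net (fun i c => X.queue t i c ω) s := by
  refine le_trans (le_of_eq ?_) (le_maxWeight_of_mem_stabilityRegion hlam
    (fun i c => queue_nonneg hX hA t i c ω) fun c => hX.queue_self t c ω)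
  simp only [Finset.mul_sum, ← Finset.sum_add_distrib]
  refine Finset.sum_congr rfl fun i _ => Finset.sum_congr rfl fun c _ => ?_
  split_ifs with h
  · subst h; simp [hX.queue_self]
  · ring

variable [IsProbabilityMeasure P]

/-- Inside the stability region, biased backpressure has negative Lyapunov drift over windows. -/
theorem exists_negative_drift [Finite Act] (hB : 0 ≤ B) (hX : IsExecution net P F X)
    (hA : Admissible net lam P F X) (hBP : IsBPBias net B Ω X) (hε : 0 < ε)
    (hlam : (fun i c => if i = c then lam i c else lam i c + ε) ∈ stabilityRegion net) :
    ∃ K : ℕ, 0 < K ∧ ∃ C : ℝ, ∀ t₀, ∫ ω, lyapunov X (t₀ + K) ω ∂P ≤ ∫ ω, lyapunov X t₀ ω ∂P + C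
      - K * ε * ∑ i, ∑ c, ∫ ω, X.queue t₀ i c ω ∂P := by
  obtain ⟨R, hR₀, hR⟩ := exists_rateBound net
  obtain ⟨M, hM₀, hM⟩ := exists_integral_sq_totalArr_le hA
  -- The slack contributes `2 * K * ε * Q` to the decrease; the averaging errors `2 * K * δ * (1 +
  -- R) * Q` use up exactly half of it.
  set δ := ε / (2 * (1 + R)) with hδ
  have hδ₀ : 0 < δ := by positivity
  have hδR : δ * (1 + R) = ε / 2 := by rw [hδ]; field_simp
  obtain ⟨K, hK, hconv⟩ := hA.convergence δ hδ₀
  obtain ⟨C₁, C₂, hdrift⟩ := lyapunov_window_le_of_isBPBias hB hX hA hR₀ hR hBP K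
  refine ⟨K, hK, C₁ + |C₂| * (K * M), fun t₀ => ?_⟩
  have hqi := queue_integrable hX hA hR₀ hR t₀
  have hLi := lyapunov_integrable hX hA hR₀ hR
  have hq₂ := queue_memLp hX hA hR₀ hR t₀
  have hqsum : Integrable (fun ω => ∑ i, ∑ c, X.queue t₀ i c ω) P :=
    integrable_finsetSum _ fun i _ => integrable_finsetSum _ fun c _ => hqi i c
  have hqsum_eq : ∫ ω, ∑ i, ∑ c, X.queue t₀ i c ω ∂P = ∑ i, ∑ c, ∫ ω, X.queue t₀ i c ω ∂P := by
    rw [integral_finsetSum _ fun i _ => integrable_finsetSum _ fun c _ => hqi i c]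
    exact Finset.sum_congr rfl fun i _ => integral_finsetSum _ fun c _ => hqi i c
  set Q := ∑ i, ∑ c, ∫ ω, X.queue t₀ i c ω ∂P with hQ
  have hZm : ∀ s, StronglyMeasurable[F t₀]
      fun ω => maxWeight net (fun i c => X.queue t₀ i c ω) s := fun s =>
    (measurable_maxWeight_queue hX hA t₀ s).stronglyMeasurable
  have hZle : ∀ s ω, maxWeight net (fun i c => X.queue t₀ i c ω) s
      ≤ R * ∑ i, ∑ c, X.queue t₀ i c ω := fun s ω =>
    maxWeight_le_mul_sum hR₀ hR (fun i c => queue_nonneg hX hA t₀ i c ω) s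
  have hZi : ∀ s, Integrable (fun ω => maxWeight net (fun i c => X.queue t₀ i c ω) s) P :=
    fun s => (hqsum.const_mul R).mono' ((hZm s).mono (F.le t₀)).aestronglyMeasurable
      (ae_of_all _ fun ω => by
        rw [Real.norm_of_nonneg (maxWeight_nonneg net _ s)]; exact hZle s ω)
  have harr : ∀ i c, ∫ ω, X.queue t₀ i c ω * ∑ τ ∈ Finset.Ico t₀ (t₀ + K), X.arr τ i c ω ∂P
      ≤ K * (lam i c * ∫ ω, X.queue t₀ i c ω ∂P) + K * δ * ∫ ω, X.queue t₀ i c ω ∂P := by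
    intro i c
    have := abs_integral_mul_window_sub_le hK (F.le t₀) (fun t => arr_memLp hA t i c)
      ((hconv t₀).1 i c) (queue_measurable hX hA t₀ i c).stronglyMeasurable (hq₂ i c)
      (fun ω => queue_nonneg hX hA t₀ i c ω)
    linarith [(abs_le.1 this).2]
  have harr' := Finset.sum_le_sum fun i (_ : i ∈ Finset.univ) =>
    Finset.sum_le_sum fun c (_ : c ∈ Finset.univ) => harr i c
  simp only [Finset.sum_add_distrib, ← Finset.mul_sum] at harr'
  have hst := abs_integral_state_window_sub_le hA hK (hconv t₀).2 hZm
    (fun s ω => maxWeight_nonneg net _ s) hZle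
    (fun ω => mul_nonneg hR₀ (Finset.sum_nonneg fun i _ => Finset.sum_nonneg fun c _ =>
      queue_nonneg hX hA t₀ i c ω)) (hqsum.const_mul R)
  rw [integral_const_mul, hqsum_eq] at hst
  have hst' := (abs_le.1 hst).1
  have hlamq : Integrable (fun ω => ∑ i, ∑ c, lam i c * X.queue t₀ i c ω) P :=
    integrable_finsetSum _ fun i _ => integrable_finsetSum _ fun c _ => (hqi i c).const_mul _
  have hregion : ∑ i, ∑ c, lam i c * ∫ ω, X.queue t₀ i c ω ∂P + ε * Q
      ≤ ∑ s, net.freq s * ∫ ω, maxWeight net (fun i c => X.queue t₀ i c ω) s ∂P := by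
    have h := integral_mono (hlamq.add (hqsum.const_mul ε))
      (integrable_finsetSum _ fun s _ => (hZi s).const_mul (net.freq s))
      (fun ω => queue_weight_le hX hA hlam t₀ ω)
    rw [integral_add' hlamq (hqsum.const_mul ε), integral_const_mul, hqsum_eq,
      integral_finsetSum _ fun s _ => (hZi s).const_mul (net.freq s),
      integral_finsetSum _ fun i _ => integrable_finsetSum _ fun c _ =>
        (hqi i c).const_mul _,
      Finset.sum_congr rfl fun i _ => integral_finsetSum _ fun c _ =>
        (hqi i c).const_mul (lam i c)] at h
    simpa only [integral_const_mul] using h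
  have hia : ∀ i c, Integrable
      (fun ω => X.queue t₀ i c ω * ∑ τ ∈ Finset.Ico t₀ (t₀ + K), X.arr τ i c ω) P := fun i c =>
    (hq₂ i c).integrable_mul (memLp_finsetSum _ fun τ _ => arr_memLp hA τ i c)
  have hi₁ : Integrable (fun ω => lyapunov X t₀ ω + C₁) P := (hLi t₀).add (integrable_const _)
  have hi₂ : Integrable
      (fun ω => C₂ * ∑ τ ∈ Finset.Ico t₀ (t₀ + K), totalArr X τ ω ^ 2) P :=
    (integrable_finsetSum _ fun r _ => (totalArr_memLp hA r).integrable_sq).const_mul _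
  have hi₃ : Integrable (fun ω => 2 * ∑ i, ∑ c, X.queue t₀ i c ω *
      ∑ τ ∈ Finset.Ico t₀ (t₀ + K), X.arr τ i c ω) P :=
    (integrable_finsetSum _ fun i _ => integrable_finsetSum _ fun c _ => hia i c).const_mul 2
  have hi₄ : Integrable (fun ω => 2 * ∑ τ ∈ Finset.Ico t₀ (t₀ + K),
      maxWeight net (fun i c => X.queue t₀ i c ω) (X.state τ ω)) P :=
    (integrable_finsetSum _ fun τ _ => integrable_comp_state hA hZi τ).const_mul 2
  have hmono := integral_mono (hLi (t₀ + K)) (((hi₁.add hi₂).add hi₃).sub hi₄) (hdrift t₀)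
  rw [integral_sub' ((hi₁.add hi₂).add hi₃) hi₄, integral_add' (hi₁.add hi₂) hi₃,
    integral_add' hi₁ hi₂, integral_add (hLi t₀) (integrable_const _), integral_const_mul,
    integral_const_mul, integral_const_mul,
    integral_finsetSum _ fun i _ => integrable_finsetSum _ fun c _ => hia i c,
    Finset.sum_congr rfl fun i _ => integral_finsetSum _ fun c _ => hia i c] at hmono
  simp only [integral_const, probReal_univ, one_smul] at hmono
  have hsq : C₂ * ∫ ω, ∑ τ ∈ Finset.Ico t₀ (t₀ + K), totalArr X τ ω ^ 2 ∂P
      ≤ |C₂| * (K * M) := by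
    refine mul_le_mul (le_abs_self _) ?_
      (integral_nonneg fun ω => Finset.sum_nonneg fun τ _ => sq_nonneg _) (abs_nonneg _)
    rw [integral_finsetSum _ fun r _ => (totalArr_memLp hA r).integrable_sq]
    exact (Finset.sum_le_sum fun r _ => hM r).trans (by simp)
  have hKreg := mul_le_mul_of_nonneg_left hregion (Nat.cast_nonneg (α := ℝ) K)
  have hKδ : (K : ℝ) * δ * Q + K * δ * (R * Q) = K * (ε / 2) * Q := by rw [← hδR]; ring
  linarith

theorem stable_of_isBPBias [Finite Act] (hB : 0 ≤ B) (hX : IsExecution net P F X)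
    (hA : Admissible net lam P F X) (hBP : IsBPBias net B Ω X) (hε : 0 < ε)
    (hlam : (fun i c => if i = c then lam i c else lam i c + ε) ∈ stabilityRegion net) :
    Stable P X := by
  obtain ⟨R, hR₀, hR⟩ := exists_rateBound net
  obtain ⟨K, hK, C, hdrift⟩ := exists_negative_drift hB hX hA hBP hε hlam
  have hK' : (0 : ℝ) < K := by exact_mod_cast hK
  have hL₀ : ∀ t, 0 ≤ ∫ ω, lyapunov X t ω ∂P := fun t => integral_nonneg fun ω =>
    Finset.sum_nonneg fun i _ => Finset.sum_nonneg fun c _ => sq_nonneg _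
  have hq₀ : ∀ t i c, 0 ≤ ∫ ω, X.queue t i c ω ∂P := fun t i c =>
    integral_nonneg fun ω => queue_nonneg hX hA t i c ω
  set D := ∑ t ∈ Finset.range K, ∫ ω, lyapunov X t ω ∂P with hD
  have hD₀ : 0 ≤ D := Finset.sum_nonneg fun t _ => hL₀ t
  have hsum : ∀ T : ℕ, K * ε * ∑ t ∈ Finset.range T, ∑ i, ∑ c, ∫ ω, X.queue t i c ω ∂P
      ≤ |C| * T + D := by
    intro T
    have h₁ := Finset.sum_le_sum fun t (_ : t ∈ Finset.range T) => hdrift t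
    simp only [Finset.sum_add_distrib, Finset.sum_sub_distrib, ← Finset.mul_sum,
      Finset.sum_const, Finset.card_range, nsmul_eq_mul] at h₁
    -- Summing the `K`-step drift over all `t < T` telescopes up to the first `K` Lyapunov values,
    -- collected in `D`; `T` need not be a multiple of `K`.
    have h₂ := Finset.sum_range_add (fun t => ∫ ω, lyapunov X t ω ∂P) K T
    have h₃ : ∑ t ∈ Finset.range T, ∫ ω, lyapunov X t ω ∂P
        ≤ ∑ t ∈ Finset.range (K + T), ∫ ω, lyapunov X t ω ∂P :=
      Finset.sum_le_sum_of_subset_of_nonneg (Finset.range_mono (Nat.le_add_left T K))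
        fun t _ _ => hL₀ t
    simp only [add_comm K] at h₂ h₃
    have h₄ : (T : ℝ) * C ≤ |C| * T := by
      rw [mul_comm]; exact mul_le_mul_of_nonneg_right (le_abs_self C) (Nat.cast_nonneg T)
    linarith
  intro i c
  refine tendsto_overflow_of_sum_integral_le (C := (|C| + D) / (K * ε))
    (fun t => queue_measurable' hX hA t i c) (fun t ω => queue_nonneg hX hA t i c ω)
    (fun t => queue_integrable hX hA hR₀ hR t i c) fun T => ?_
  have h₁ : ∑ t ∈ Finset.range T, ∫ ω, X.queue t i c ω ∂P
      ≤ ∑ t ∈ Finset.range T, ∑ i, ∑ c, ∫ ω, X.queue t i c ω ∂P :=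
    Finset.sum_le_sum fun t _ => le_sum_sum (hq₀ t) i c
  refine h₁.trans ?_
  rw [div_mul_eq_mul_div, ← add_div, le_div_iff₀ (by positivity), mul_comm]
  refine (hsum T).trans ?_
  nlinarith [abs_nonneg C, mul_nonneg hD₀ (Nat.cast_nonneg (α := ℝ) T)]

end Sufficiency

/-! ### Q-learning estimates as bounded biases -/

section QLearning

variable {N St Act : Type*} [Fintype N] [DecidableEq N] [Fintype St]
variable {net : Network N St Act} {α γ Bmax : ℝ}

theorem leastEstimate_mem_Icc (hB : 0 ≤ Bmax) {Q : N → N → N → ℝ}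
    (hQ : ∀ i j c, 0 ≤ Q i j c ∧ Q i j c ≤ Bmax) (i c : N) :
    0 ≤ leastEstimate net Bmax Q i c ∧ leastEstimate net Bmax Q i c ≤ Bmax := by
  unfold leastEstimate
  split_ifs with h₁ h₂
  · exact ⟨le_rfl, hB⟩
  · obtain ⟨j, hj⟩ := h₂
    exact ⟨Finset.le_inf' _ _ fun j _ => (hQ i j c).1,
      (Finset.inf'_le _ hj).trans (hQ i j c).2⟩
  · exact ⟨hB, le_rfl⟩

theorem estimates_mem_Icc (hB : 0 ≤ Bmax) (hα₀ : 0 ≤ α) (hα₁ : α ≤ 1) (hγ₀ : 0 ≤ γ)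
    {Q₀ : N → N → N → ℝ} (hQ₀ : ∀ i j c, 0 ≤ Q₀ i j c ∧ Q₀ i j c ≤ Bmax)
    {q : ℕ → N → N → ℝ} (hq : ∀ t i c, 0 ≤ q t i c) (t : ℕ) (i j c : N) :
    0 ≤ estimates net α γ Bmax Q₀ q t i j c ∧ estimates net α γ Bmax Q₀ q t i j c ≤ Bmax := by
  induction t generalizing i j c with
  | zero => exact hQ₀ i j c
  | succ t ih =>
    refine ⟨le_min ?_ hB, min_le_right _ _⟩
    exact add_nonneg (mul_nonneg (sub_nonneg.2 hα₁) (ih i j c).1)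
      (mul_nonneg hα₀ (add_nonneg (hq t j c) (mul_nonneg hγ₀ (leastEstimate_mem_Icc hB ih j c).1)))

/-- The cap bounds the estimates above, and nonnegative backlogs with `α ≤ 1` keep them nonnegative.
Convergence of the learning plays no role. -/
theorem isBPBias_of_isQLBP (hB : 0 ≤ Bmax) (hα₀ : 0 ≤ α) (hα₁ : α ≤ 1) (hγ₀ : 0 ≤ γ)
    {Q₀ : N → N → N → ℝ} (hQ₀ : ∀ i j c, 0 ≤ Q₀ i j c ∧ Q₀ i j c ≤ Bmax)
    {Ω : Type*} {X : Trajectory N St Act Ω} (hq : ∀ t i c ω, 0 ≤ X.queue t i c ω)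
    (h : IsQLBP net α γ Bmax Q₀ Ω X) : IsBPBias net Bmax Ω X :=
  ⟨_, fun t i c ω => leastEstimate_mem_Icc hB
      (estimates_mem_Icc hB hα₀ hα₁ hγ₀ hQ₀ (fun τ k d => hq τ k d ω) (t + 1)) i c,
    fun _ _ _ => if_pos rfl, h⟩

end QLearning

end Backpressure

theorem mainTheorem1 {N St Act : Type*}
    [Fintype N] [DecidableEq N] [Fintype St] [DecidableEq St] [Finite Act]
    (net : Backpressure.Network N St Act) (Bmax : ℝ) (hB : 0 < Bmax) :
    Backpressure.ThroughputOptimal net (fun Ω : Type u => Backpressure.IsBPBias net Bmax Ω) ∧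
    ∀ (α γ : ℝ), 0 < α → α ≤ 1 → 0 < γ → γ ≤ 1 →
      ∀ Q₀ : N → N → N → ℝ, (∀ i j c, 0 ≤ Q₀ i j c ∧ Q₀ i j c ≤ Bmax) →
        Backpressure.ThroughputOptimal net
          (fun Ω : Type u => Backpressure.IsQLBP net α γ Bmax Q₀ Ω) := by
  refine ⟨fun lam ε hε hlam Ω mΩ P F X hP hA hX hBP =>
    Backpressure.stable_of_isBPBias hB.le hX hA hBP hε hlam, ?_⟩
  intro α γ hα₀ hα₁ hγ₀ _ Q₀ hQ₀ lam ε hε hlam Ω mΩ P F X hP hA hX hQL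
  exact Backpressure.stable_of_isBPBias hB.le hX hA (Backpressure.isBPBias_of_isQLBP hB.le
    hα₀.le hα₁ hγ₀.le hQ₀ (Backpressure.queue_nonneg hX hA) hQL) hε hlam
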